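/- \textbf{Notation.} For a symmetric positive semidefinite $A\in\mathbb R^{d\times d}$ with Moore--Penrose pseudoinverse $A^\dagger$ write $\|z\|_A=(z^TA^\dagger z)^{1/2}$. Let $n$ be even, let $H_1=\{1,\dots,n/2\}$ and $H_2=\{n/2+1,\dots,n\}$, and for $z_1,\dots,z_n\in\mathbb R^d$ and $H\in\{H_1,H_2\}$ put $\hat\Sigma_H=\frac1n\sum_{i\in H}z_iz_i^T$ (normalised by $n$). The data set $(z_i)_{i\le n}$ is \emph{$\beta$-norm bounded} if $z_i^T\hat\Sigma_H^\dagger z_i\le\beta^2$ for all $i\in\{1,\dots,n\}$ and both $H\in\{H_1,H_2\}$. \textbf{Lemma (Heavy-tailed norm-boundedness).} There is a universal constant $C>0$ such that the following holds for all $d\ge1$, all even $n$, all $\delta\in(0,1)$ and all real $b_{\mathsf{clip}}$ with $n\ge C\,b_{\mathsf{clip}}^2\log(2d/\delta)$. (a) Let $k>2$ and $m_k\ge0$ be real, and let $Z_1,\dots,Z_n$ be i.i.d. random vectors in $\mathbb R^d$ with $E\|Z_1\|^k<\infty$ and second-moment matrix $\Sigma=E[Z_1Z_1^T]$ (possibly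 singular) such that $E|v^TZ_1|^k\le m_k^k\,(v^T\Sigma v)^{k/2}$ for all $v\in\mathbb R^d$. Let $b_{\mathsf{clip}}\ge0$ be large enough that $m_k^2\,(m_k\sqrt d)^{k-2}\le\frac13\,b_{\mathsf{clip}}^{k-2}$. Let $\bar Z_i=c(Z_i)$, where $c:\mathbb R^d\to\mathbb R^d$ is measurable, $c(z)=z$ whenever $\|z\|_\Sigma\le b_{\mathsf{clip}}$, and, for every $z$, $\|c(z)\|_\Sigma\le b_{\mathsf{clip}}$ and $c(z)=tz$ for some $t\in[0,1]$ (for example $c(z)=z\,\mathbf 1\{\|z\|_\Sigma\le b_{\mathsf{clip}}\}$, or the radial projection to $\{\|z\|_\Sigma\le b_{\mathsf{clip}}\}$). Then with probability at least $1-2\delta$ the clipped sample $\bar Z_1,\dots,\bar Z_n$ is $\frac{3}{\sqrt2}b_{\mathsf{clip}}$-norm bounded, that is, $\bar Z_i^T\hat\Sigma_H^\dagger\bar Z_i\le\frac92 b_{\mathsf{clip}}^2$ for every $i$ and both halves $H$. (b) More generally, the same conclusion holds for all i.i.d. random vectors $\bar Z_1,\dots,\bar Z_n$ in $\mathbb R^d$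 with $E\|\bar Z_1\|^2<\infty$ and $\|\bar Z_1\|_{\bar\Sigma}\le\sqrt{3/2}\,b_{\mathsf{clip}}$ almost surely, where $\bar\Sigma=E[\bar Z_1\bar Z_1^T]$. -/

import Mathlib

open MeasureTheory ProbabilityTheory Matrix

noncomputable section

namespace HeavyTail

/-- The Moore-Penrose pseudoinverse `A†` of a symmetric real matrix: the function `x ↦ x⁻¹`
(with `0 ↦ 0`) applied to the eigenvalues of `A`. It is only used at symmetric matrices; the
Penrose equations are proved below. -/
def pinv {d : ℕ} (A : Matrix (Fin d) (Fin d) ℝ) : Matrix (Fin d) (Fin d) ℝ :=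
  cfc (fun x : ℝ => x⁻¹) A

/-- On symmetric matrices `pinv` satisfies the four Penrose equations, which characterise the
Moore-Penrose pseudoinverse. -/
theorem pinv_penrose {d : ℕ} (A : Matrix (Fin d) (Fin d) ℝ) (hA : A.IsHermitian) :
    A * pinv A * A = A ∧ pinv A * A * pinv A = pinv A ∧
      (A * pinv A).IsHermitian ∧ (pinv A * A).IsHermitian := by
  have hA' : IsSelfAdjoint A := hA
  have hc : ∀ f : ℝ → ℝ, ContinuousOn f (spectrum ℝ A) := fun f =>
    (Matrix.finite_real_spectrum (A := A)).continuousOn f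
  have h1 : A * pinv A = cfc (fun x : ℝ => x * x⁻¹) A := by
    rw [cfc_mul (fun x : ℝ => x) (fun x : ℝ => x⁻¹) A (hc _) (hc _), cfc_id' ℝ A]
    rfl
  have h2 : pinv A * A = cfc (fun x : ℝ => x⁻¹ * x) A := by
    rw [cfc_mul (fun x : ℝ => x⁻¹) (fun x : ℝ => x) A (hc _) (hc _), cfc_id' ℝ A]
    rfl
  refine ⟨?_, ?_, ?_, ?_⟩
  · rw [h1]
    conv_lhs => arg 2; rw [← cfc_id' ℝ A]
    rw [← cfc_mul _ _ A (hc _) (hc _)]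
    refine (cfc_congr fun x _ => ?_).trans (cfc_id' ℝ A)
    exact mul_inv_mul_cancel x
  · rw [h2]
    unfold pinv
    rw [← cfc_mul _ _ A (hc _) (hc _)]
    refine cfc_congr fun x _ => ?_
    by_cases hx : x = 0 <;> simp [hx]
  · rw [h1]
    exact cfc_predicate (R := ℝ) _ A
  · rw [h2]
    exact cfc_predicate (R := ℝ) _ A

/-- The norm `‖z‖_A = (zᵀ A† z)^{1/2}` induced by a positive semidefinite matrix `A`. -/
def psdNorm {d : ℕ} (A : Matrix (Fin d) (Fin d) ℝ) (z : Fin d → ℝ) : ℝ :=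
  √(z ⬝ᵥ pinv A *ᵥ z)

/-- The second-moment matrix `E[Z Zᵀ]` of a law `P` on `ℝᵈ`. -/
def secondMoment {d : ℕ} (P : Measure (Fin d → ℝ)) : Matrix (Fin d) (Fin d) ℝ :=
  Matrix.of fun i j => ∫ z, z i * z j ∂P

/-- `Σ̂_H = (1/n) ∑_{i ∈ H} z_i z_iᵀ`, normalised by `n` and not by the size of `H`. -/
def scov {d n : ℕ} (z : Fin n → Fin d → ℝ) (H : Finset (Fin n)) : Matrix (Fin d) (Fin d) ℝ :=
  (1 / (n : ℝ)) • ∑ i ∈ H, vecMulVec (z i) (z i)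

/-- The first half `{1, …, n/2}` of the indices. -/
def firstHalf (n : ℕ) : Finset (Fin n) := Finset.univ.filter fun i => (i : ℕ) < n / 2

/-- The second half `{n/2 + 1, …, n}` of the indices. -/
def secondHalf (n : ℕ) : Finset (Fin n) := Finset.univ.filter fun i => n / 2 ≤ (i : ℕ)

/-- The data set `z` is `b`-norm bounded: `z_iᵀ Σ̂_H† z_i ≤ b²` for all `i` and both halves `H`. -/
def NormBounded {d n : ℕ} (z : Fin n → Fin d → ℝ) (b : ℝ) : Prop :=
  ∀ H : Finset (Fin n), H = firstHalf n ∨ H = secondHalf n →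
    ∀ i : Fin n, z i ⬝ᵥ pinv (scov z H) *ᵥ z i ≤ b ^ 2

/-- `Z` is an i.i.d. sample of size `n` from `P`, on the probability space `(Ω, μ)`. -/
def IsIIDSample {d n : ℕ} {Ω : Type*} [MeasurableSpace Ω] (Z : Fin n → Ω → Fin d → ℝ)
    (P : Measure (Fin d → ℝ)) (μ : Measure Ω) : Prop :=
  (∀ i, Measurable (Z i)) ∧ (∀ i, μ.map (Z i) = P) ∧ iIndepFun Z μ

/-- The law `P` has `k`-th moments bounded by `m`: it has a finite `k`-th absolute moment and, with
`Σ = E[Z Zᵀ]`, `E |⟨v, Z⟩|ᵏ ≤ mᵏ (vᵀ Σ v)^{k/2}` for all `v`. -/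
def HasMomentBound {d : ℕ} (P : Measure (Fin d → ℝ)) (k m : ℝ) : Prop :=
  MemLp (fun z : Fin d → ℝ => z) (ENNReal.ofReal k) P ∧
    ∀ v : Fin d → ℝ,
      ∫ z, |v ⬝ᵥ z| ^ k ∂P ≤ m ^ k * (v ⬝ᵥ secondMoment P *ᵥ v) ^ (k / 2)

/-- `c` clips vectors to the ball `{‖z‖_A ≤ b}`: it fixes the vectors of that ball, and rescales
every other vector by a factor in `[0, 1]` so that it lands in the ball. Both usual conventions
are covered: `z ↦ z · 1{‖z‖_A ≤ b}` and `z ↦ min(1, b / ‖z‖_A) z`. -/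
def IsClipping {d : ℕ} (A : Matrix (Fin d) (Fin d) ℝ) (b : ℝ)
    (c : (Fin d → ℝ) → Fin d → ℝ) : Prop :=
  Measurable c ∧ (∀ z, psdNorm A z ≤ b → c z = z) ∧
    ∀ z, psdNorm A (c z) ≤ b ∧ ∃ t : ℝ, 0 ≤ t ∧ t ≤ 1 ∧ c z = t • z

end HeavyTail

end

/-!
In coordinates that whiten the range of the second-moment matrix `Σ`, the sample becomes isotropic
and bounded, and a lower matrix Chernoff bound shows that each half satisfies `Σ ≤ 3 Σ̂_H` as
quadratic forms. Passing to pseudoinverses on the range of `Σ`, where almost every sample point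
lies, turns this into norm-boundedness.

The Chernoff bound uses the potential `tr (1 - ε ∑ j, w j (w j)ᵀ) ^ h` instead of a matrix
exponential. When a rank-one term is added, the mixed products `M' ^ p * M ^ q` are compared with
`M ^ (p + q)` through Chebyshev's sum inequality for the spectral measure of `M` at `w`, which
takes the place of the Golden-Thompson or Lieb inequality.

For the clipped sample, clipping removes mass only where `‖z‖_Σ ≥ b`, so Hölder's inequality with
exponents `k / 2` and `k / (k - 2)` bounds its effect on `vᵀ Σ v` by a third of `vᵀ Σ v`. The
clipped law is therefore bounded by `√(3/2) b` in the norm of its own second moment.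
-/

namespace HeavyTail

section SpectralMoments

variable {ι : Type*} [Fintype ι]

theorem dotProduct_self_nonneg (v : ι → ℝ) : 0 ≤ v ⬝ᵥ v := by
  simpa only [star_trivial] using dotProduct_self_star_nonneg v

theorem dotProduct_self_pos {v : ι → ℝ} (hv : v ≠ 0) : 0 < v ⬝ᵥ v :=
  (dotProduct_self_nonneg v).lt_of_ne' (dotProduct_self_eq_zero.not.2 hv)

theorem sq_dotProduct_le (v w : ι → ℝ) : (v ⬝ᵥ w) ^ 2 ≤ (v ⬝ᵥ v) * (w ⬝ᵥ w) := by
  simpa only [dotProduct, sq] using Finset.sum_mul_sq_le_sq_mul_sq Finset.univ v w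

theorem dotProduct_vecMulVec_mulVec (w v : ι → ℝ) :
    v ⬝ᵥ vecMulVec w w *ᵥ v = (w ⬝ᵥ v) ^ 2 := by
  rw [vecMulVec_mulVec, op_smul_eq_smul, dotProduct_smul, dotProduct_comm v, smul_eq_mul, sq]

theorem weighted_sum_mul_sum_le_of_monovary {μ f g : ι → ℝ} (hμ : 0 ≤ μ) (hfg : Monovary f g) :
    (∑ i, μ i * f i) * ∑ i, μ i * g i ≤ (∑ i, μ i) * ∑ i, μ i * (f i * g i) := by
  have hnonneg : 0 ≤ ∑ i, ∑ j, μ i * μ j * ((f j - f i) * (g j - g i)) :=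
    Finset.sum_nonneg fun i _ => Finset.sum_nonneg fun j _ =>
      mul_nonneg (mul_nonneg (hμ i) (hμ j)) (hfg.sub_mul_sub_nonneg i j)
  have hexpand : ∑ i, ∑ j, μ i * μ j * ((f j - f i) * (g j - g i)) =
      (∑ i, μ i) * (∑ i, μ i * (f i * g i)) + (∑ i, μ i * (f i * g i)) * (∑ i, μ i)
        - (∑ i, μ i * f i) * (∑ i, μ i * g i) - (∑ i, μ i * g i) * (∑ i, μ i * f i) := by
    simp only [Finset.sum_mul_sum, ← Finset.sum_add_distrib, ← Finset.sum_sub_distrib]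
    exact Finset.sum_congr rfl fun i _ => Finset.sum_congr rfl fun j _ => by ring
  linarith

variable {M : Matrix ι ι ℝ}

theorem exists_spectral_weights [DecidableEq ι] (hM : M.IsHermitian) (v : ι → ℝ) :
    ∃ μ : ι → ℝ, 0 ≤ μ ∧ ∀ j : ℕ, v ⬝ᵥ (M ^ j) *ᵥ v = ∑ i, μ i * hM.eigenvalues i ^ j := by
  let U : Matrix ι ι ℝ := ↑hM.eigenvectorUnitary
  have hpow (j : ℕ) : M ^ j = U * diagonal (hM.eigenvalues ^ j) * Uᵀ := by
    conv_lhs => rw [hM.spectral_theorem]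
    rw [← map_pow, Unitary.conjStarAlgAut_apply, diagonal_pow, star_eq_conjTranspose,
      conjTranspose_eq_transpose_of_trivial]
    rfl
  refine ⟨fun i => (v ᵥ* U) i ^ 2, fun i => sq_nonneg _, fun j => ?_⟩
  rw [hpow, ← mulVec_mulVec, ← mulVec_mulVec, dotProduct_mulVec, mulVec_transpose]
  simp only [dotProduct, mulVec_diagonal, Pi.pow_apply]
  exact Finset.sum_congr rfl fun i _ => by ring

theorem dotProduct_mulVec_le_trace_mul (hM : M.PosSemidef) (v : ι → ℝ) :
    v ⬝ᵥ M *ᵥ v ≤ M.trace * (v ⬝ᵥ v) := by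
  classical
  obtain ⟨μ, hμ, h⟩ := exists_spectral_weights hM.isHermitian v
  have hmass : v ⬝ᵥ v = ∑ i, μ i := by simpa using h 0
  have hmean : v ⬝ᵥ M *ᵥ v = ∑ i, μ i * hM.isHermitian.eigenvalues i := by simpa using h 1
  have htrace : M.trace = ∑ i, hM.isHermitian.eigenvalues i :=
    hM.isHermitian.trace_eq_sum_eigenvalues
  rw [hmean, hmass, htrace, Finset.mul_sum]
  refine Finset.sum_le_sum fun i _ => (mul_comm _ _).trans_le ?_
  exact mul_le_mul_of_nonneg_right
    (Finset.single_le_sum (fun j _ => hM.eigenvalues_nonneg j) (Finset.mem_univ i)) (hμ i)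

variable [DecidableEq ι]

theorem exists_dotProduct_mulVec_eq_eigenvalue (hM : M.IsHermitian) (i : ι) :
    ∃ v : ι → ℝ, v ⬝ᵥ v = 1 ∧ v ⬝ᵥ M *ᵥ v = hM.eigenvalues i := by
  refine ⟨(hM.eigenvectorBasis i).ofLp, ?_, ?_⟩
  · have h := real_inner_self_eq_norm_sq (hM.eigenvectorBasis i)
    rw [hM.eigenvectorBasis.orthonormal.1 i, EuclideanSpace.inner_eq_star_dotProduct] at h
    simpa only [star_trivial, one_pow] using h
  · simpa only [star_trivial, RCLike.re_to_real] using (hM.eigenvalues_eq i).symm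

theorem dotProduct_pow_mulVec_nonneg (hM : M.PosSemidef) (v : ι → ℝ) (j : ℕ) :
    0 ≤ v ⬝ᵥ (M ^ j) *ᵥ v := by
  simpa only [star_trivial] using (hM.pow j).dotProduct_mulVec_nonneg v

theorem dotProduct_pow_mulVec_mul_le (hM : M.PosSemidef) (v : ι → ℝ) (p q : ℕ) :
    (v ⬝ᵥ (M ^ p) *ᵥ v) * (v ⬝ᵥ (M ^ q) *ᵥ v) ≤ (v ⬝ᵥ v) * (v ⬝ᵥ (M ^ (p + q)) *ᵥ v) := by
  obtain ⟨μ, hμ, h⟩ := exists_spectral_weights hM.isHermitian v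
  have hmass : v ⬝ᵥ v = ∑ i, μ i := by simpa using h 0
  have hnonneg : 0 ≤ hM.isHermitian.eigenvalues := hM.eigenvalues_nonneg
  have hvary := ((monovary_self _).pow_left₀ hnonneg p).pow_right₀ hnonneg q
  rw [hmass, h, h, h]
  simpa only [pow_add, Pi.pow_apply] using weighted_sum_mul_sum_le_of_monovary hμ hvary

theorem mul_dotProduct_pow_mulVec_le (hM : M.PosSemidef) {a : ℝ}
    (ha : ∀ v, a * (v ⬝ᵥ v) ≤ v ⬝ᵥ M *ᵥ v) (v : ι → ℝ) (j : ℕ) :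
    a * (v ⬝ᵥ (M ^ j) *ᵥ v) ≤ v ⬝ᵥ (M ^ (j + 1)) *ᵥ v := by
  obtain ⟨μ, hμ, h⟩ := exists_spectral_weights hM.isHermitian v
  rw [h, h, Finset.mul_sum]
  refine Finset.sum_le_sum fun i _ => ?_
  obtain ⟨u, hu, hMu⟩ := exists_dotProduct_mulVec_eq_eigenvalue hM.isHermitian i
  have hle : a ≤ hM.isHermitian.eigenvalues i := by simpa only [hu, hMu, mul_one] using ha u
  calc a * (μ i * hM.isHermitian.eigenvalues i ^ j)
      ≤ hM.isHermitian.eigenvalues i * (μ i * hM.isHermitian.eigenvalues i ^ j) :=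
        mul_le_mul_of_nonneg_right hle (mul_nonneg (hμ i) (pow_nonneg (hM.eigenvalues_nonneg i) j))
    _ = μ i * hM.isHermitian.eigenvalues i ^ (j + 1) := by ring

theorem dotProduct_pow_succ_mulVec_le (hM : M.PosSemidef)
    (hM_le : ∀ v, v ⬝ᵥ M *ᵥ v ≤ v ⬝ᵥ v) (v : ι → ℝ) (j : ℕ) :
    v ⬝ᵥ (M ^ (j + 1)) *ᵥ v ≤ v ⬝ᵥ (M ^ j) *ᵥ v := by
  obtain ⟨μ, hμ, h⟩ := exists_spectral_weights hM.isHermitian v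
  rw [h, h]
  refine Finset.sum_le_sum fun i _ => mul_le_mul_of_nonneg_left ?_ (hμ i)
  obtain ⟨u, hu, hMu⟩ := exists_dotProduct_mulVec_eq_eigenvalue hM.isHermitian i
  have hle : hM.isHermitian.eigenvalues i ≤ 1 := by simpa only [hu, hMu] using hM_le u
  exact pow_le_pow_of_le_one (hM.eigenvalues_nonneg i) hle j.le_succ

theorem pow_mul_dotProduct_self_le (hM : M.PosSemidef) {a : ℝ} (ha : 0 ≤ a) {v : ι → ℝ}
    (hv : a * (v ⬝ᵥ v) ≤ v ⬝ᵥ M *ᵥ v) (N : ℕ) : a ^ N * (v ⬝ᵥ v) ≤ v ⬝ᵥ (M ^ N) *ᵥ v := by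
  rcases eq_or_ne v 0 with rfl | hv0
  · simp
  have hpos := dotProduct_self_pos hv0
  induction N with
  | zero => simp
  | succ N ih =>
    refine le_of_mul_le_mul_left ?_ hpos
    calc (v ⬝ᵥ v) * (a ^ (N + 1) * (v ⬝ᵥ v)) = (a ^ N * (v ⬝ᵥ v)) * (a * (v ⬝ᵥ v)) := by ring
      _ ≤ (v ⬝ᵥ (M ^ N) *ᵥ v) * (v ⬝ᵥ M *ᵥ v) := by
        gcongr
        exact dotProduct_pow_mulVec_nonneg hM v N
      _ ≤ (v ⬝ᵥ v) * (v ⬝ᵥ (M ^ (N + 1)) *ᵥ v) := by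
        simpa only [pow_one] using dotProduct_pow_mulVec_mul_le hM v N 1

theorem pow_le_trace_pow (hM : M.PosSemidef) {a : ℝ} (ha : 0 ≤ a) {v : ι → ℝ}
    (hv : a * (v ⬝ᵥ v) < v ⬝ᵥ M *ᵥ v) (N : ℕ) : a ^ N ≤ (M ^ N).trace := by
  have hv0 : v ≠ 0 := by rintro rfl; simp at hv
  exact le_of_mul_le_mul_right ((pow_mul_dotProduct_self_le hM ha hv.le N).trans
    (dotProduct_mulVec_le_trace_mul (hM.pow N) v)) (dotProduct_self_pos hv0)

end SpectralMoments

section RankOnePerturbation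

variable {ι : Type*} [Fintype ι] [DecidableEq ι] {M M' : Matrix ι ι ℝ} {ε : ℝ} {w : ι → ℝ}

theorem pow_succ_mul_pow_of_eq_sub_vecMulVec (h : M' = M - ε • vecMulVec w w) (p q : ℕ) :
    M' ^ (p + 1) * M ^ q =
      M' ^ p * M ^ (q + 1) - ε • vecMulVec (M' ^ p *ᵥ w) (w ᵥ* M ^ q) := by
  rw [pow_succ, pow_succ', mul_assoc, ← vecMulVec_mul, ← mul_vecMulVec, mul_assoc,
    ← mul_smul_comm, ← mul_sub, ← smul_mul_assoc, ← sub_mul, ← h]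

theorem dotProduct_pow_succ_mul_pow_mulVec (h : M' = M - ε • vecMulVec w w) (p q : ℕ) :
    w ⬝ᵥ (M' ^ (p + 1) * M ^ q) *ᵥ w =
      w ⬝ᵥ (M' ^ p * M ^ (q + 1)) *ᵥ w - ε * ((w ⬝ᵥ (M' ^ p) *ᵥ w) * (w ⬝ᵥ (M ^ q) *ᵥ w)) := by
  rw [pow_succ_mul_pow_of_eq_sub_vecMulVec h, sub_mulVec, dotProduct_sub, smul_mulVec,
    vecMulVec_mulVec, op_smul_eq_smul, dotProduct_smul, dotProduct_smul, ← dotProduct_mulVec,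
    smul_eq_mul, smul_eq_mul, mul_comm (w ⬝ᵥ (M ^ q) *ᵥ w)]

theorem trace_pow_succ_mul_pow (h : M' = M - ε • vecMulVec w w) (hM : M.IsHermitian)
    (hM' : M'.IsHermitian) (p q : ℕ) :
    (M' ^ (p + 1) * M ^ q).trace =
      (M' ^ p * M ^ (q + 1)).trace - ε * (w ⬝ᵥ (M' ^ p * M ^ q) *ᵥ w) := by
  have hsymm {A : Matrix ι ι ℝ} (hA : A.IsHermitian) (j : ℕ) : w ᵥ* A ^ j = A ^ j *ᵥ w := by
    rw [← mulVec_transpose, ← conjTranspose_eq_transpose_of_trivial, (hA.pow j).eq]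
  rw [pow_succ_mul_pow_of_eq_sub_vecMulVec h, trace_sub, trace_smul, trace_vecMulVec, smul_eq_mul,
    ← hsymm hM', hsymm hM, ← dotProduct_mulVec, mulVec_mulVec]

theorem dotProduct_pow_mul_pow_mulVec_le (h : M' = M - ε • vecMulVec w w) (hM : M.PosSemidef)
    (hM' : M'.PosSemidef) (hε : 0 ≤ ε) (p q : ℕ) :
    w ⬝ᵥ (M' ^ p * M ^ q) *ᵥ w ≤ w ⬝ᵥ (M ^ (p + q)) *ᵥ w := by
  induction p generalizing q with
  | zero => simp
  | succ p ih =>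
    rw [dotProduct_pow_succ_mul_pow_mulVec h, add_right_comm, add_assoc]
    have hdrop : 0 ≤ ε * ((w ⬝ᵥ (M' ^ p) *ᵥ w) * (w ⬝ᵥ (M ^ q) *ᵥ w)) :=
      mul_nonneg hε (mul_nonneg (dotProduct_pow_mulVec_nonneg hM' w p)
        (dotProduct_pow_mulVec_nonneg hM w q))
    linarith [ih (q + 1)]

theorem mul_dotProduct_pow_mulVec_le_pow_mul_pow (h : M' = M - ε • vecMulVec w w)
    (hM : M.PosSemidef) (hM' : M'.PosSemidef) (hε : 0 ≤ ε) {a : ℝ} (ha : 0 < a)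
    (hlow : ∀ v, a * (v ⬝ᵥ v) ≤ v ⬝ᵥ M *ᵥ v) (p q : ℕ) :
    (1 - p * ε * (w ⬝ᵥ w) / a) * (w ⬝ᵥ (M ^ (p + q)) *ᵥ w) ≤ w ⬝ᵥ (M' ^ p * M ^ q) *ᵥ w := by
  induction p generalizing q with
  | zero => simp
  | succ p ih =>
    have hw := dotProduct_self_nonneg w
    have hcross : (w ⬝ᵥ (M' ^ p) *ᵥ w) * (w ⬝ᵥ (M ^ q) *ᵥ w) ≤
        (w ⬝ᵥ w) / a * (w ⬝ᵥ (M ^ (p + q + 1)) *ᵥ w) :=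
      calc (w ⬝ᵥ (M' ^ p) *ᵥ w) * (w ⬝ᵥ (M ^ q) *ᵥ w)
          ≤ (w ⬝ᵥ (M ^ p) *ᵥ w) * (w ⬝ᵥ (M ^ q) *ᵥ w) := by
            gcongr
            · exact dotProduct_pow_mulVec_nonneg hM w q
            · simpa using dotProduct_pow_mul_pow_mulVec_le h hM hM' hε p 0
        _ ≤ (w ⬝ᵥ w) / a * (a * (w ⬝ᵥ (M ^ (p + q)) *ᵥ w)) := by
            rw [← mul_assoc, div_mul_cancel₀ _ ha.ne']
            exact dotProduct_pow_mulVec_mul_le hM w p q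
        _ ≤ (w ⬝ᵥ w) / a * (w ⬝ᵥ (M ^ (p + q + 1)) *ᵥ w) := by
            gcongr
            exact mul_dotProduct_pow_mulVec_le hM hlow w (p + q)
    have hε_cross := mul_le_mul_of_nonneg_left hcross hε
    have ih' := ih (q + 1)
    rw [← add_assoc] at ih'
    rw [dotProduct_pow_succ_mul_pow_mulVec h, add_right_comm]
    push_cast
    linear_combination ih' + hε_cross

theorem trace_pow_sub_vecMulVec_le (h : M' = M - ε • vecMulVec w w) (hM : M.PosSemidef)
    (hM' : M'.PosSemidef) (hε : 0 ≤ ε) {a r : ℝ} (ha : 0 < a) (hr : r ≤ 1)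
    (hlow : ∀ v, a * (v ⬝ᵥ v) ≤ v ⬝ᵥ M *ᵥ v) (hup : ∀ v, v ⬝ᵥ M *ᵥ v ≤ v ⬝ᵥ v) {N : ℕ}
    (hN : N * ε * (w ⬝ᵥ w) / a ≤ r) :
    (M' ^ N).trace ≤ (M ^ N).trace - (1 - r) * ε * N * (w ⬝ᵥ (M ^ N) *ᵥ w) := by
  suffices hmixed : ∀ p ≤ N, ∀ q, (M' ^ p * M ^ q).trace ≤
      (M ^ (p + q)).trace - (1 - r) * ε * p * (w ⬝ᵥ (M ^ (p + q)) *ᵥ w) by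
    simpa using hmixed N le_rfl 0
  intro p hp
  induction p with
  | zero => simp
  | succ p ih =>
    intro q
    have hw := dotProduct_self_nonneg w
    have hform : (1 - r) * (w ⬝ᵥ (M ^ (p + q + 1)) *ᵥ w) ≤ w ⬝ᵥ (M' ^ p * M ^ q) *ᵥ w :=
      calc (1 - r) * (w ⬝ᵥ (M ^ (p + q + 1)) *ᵥ w)
          ≤ (1 - p * ε * (w ⬝ᵥ w) / a) * (w ⬝ᵥ (M ^ (p + q)) *ᵥ w) := by
            have hpN : p * ε * (w ⬝ᵥ w) / a ≤ N * ε * (w ⬝ᵥ w) / a := by gcongr; omega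
            refine mul_le_mul (by linarith) (dotProduct_pow_succ_mulVec_le hM hup w (p + q))
              (dotProduct_pow_mulVec_nonneg hM w _) (by linarith)
        _ ≤ w ⬝ᵥ (M' ^ p * M ^ q) *ᵥ w :=
            mul_dotProduct_pow_mulVec_le_pow_mul_pow h hM hM' hε ha hlow p q
    have ih' := ih (by omega) (q + 1)
    rw [← add_assoc] at ih'
    rw [trace_pow_succ_mul_pow h hM.isHermitian hM'.isHermitian, add_right_comm]
    push_cast
    linear_combination ih' + ε * hform

end RankOnePerturbation

section Isotropic

variable {ι Ω : Type*} [DecidableEq ι] [MeasurableSpace Ω] {μ : Measure Ω} {X : Ω → ι → ℝ}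

/-- A random vector is isotropic if its second-moment matrix is the identity. It need not be
centred. -/
def Isotropic (X : Ω → ι → ℝ) (μ : Measure Ω) : Prop :=
  ∀ a b, ∫ ω, X ω a * X ω b ∂μ = (1 : Matrix ι ι ℝ) a b

theorem Isotropic.integrable_mul_self (hX : Isotropic X μ) (a : ι) :
    Integrable (fun ω => X ω a * X ω a) μ :=
  .of_integral_ne_zero (by rw [hX a a, one_apply_eq]; exact one_ne_zero)

theorem Isotropic.integrable_mul (hX : Isotropic X μ) (hXm : AEStronglyMeasurable X μ) (a b : ι) :
    Integrable (fun ω => X ω a * X ω b) μ := by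
  have hmemLp (c : ι) : MemLp (fun ω => X ω c) 2 μ :=
    (memLp_two_iff_integrable_sq ((continuous_apply c).comp_aestronglyMeasurable hXm)).2
      (by simpa only [sq] using hX.integrable_mul_self c)
  exact (hmemLp a).integrable_mul (hmemLp b)

variable [Fintype ι]

theorem Isotropic.card_le [IsProbabilityMeasure μ] (hX : Isotropic X μ) {L : ℝ}
    (hXL : ∀ᵐ ω ∂μ, X ω ⬝ᵥ X ω ≤ L) : Fintype.card ι ≤ L := by
  have hint : Integrable (fun ω => X ω ⬝ᵥ X ω) μ :=
    integrable_finsetSum _ fun a _ => hX.integrable_mul_self a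
  calc (Fintype.card ι : ℝ) = ∫ ω, X ω ⬝ᵥ X ω ∂μ := by
        simp only [dotProduct, integral_finsetSum _ fun a _ => hX.integrable_mul_self a, hX _ _,
          one_apply_eq, Finset.sum_const, Finset.card_univ, nsmul_one]
    _ ≤ ∫ _, L ∂μ := integral_mono_ae hint (integrable_const L) hXL
    _ = L := by simp

theorem Isotropic.integral_dotProduct_mulVec (hX : Isotropic X μ)
    (hXm : AEStronglyMeasurable X μ) {D : Ω → Matrix ι ι ℝ}
    (hD : ∀ a b, Integrable (fun ω => D ω a b) μ)
    (hind : ∀ a b, IndepFun X (fun ω => D ω a b) μ) :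
    Integrable (fun ω => X ω ⬝ᵥ D ω *ᵥ X ω) μ ∧
      ∫ ω, X ω ⬝ᵥ D ω *ᵥ X ω ∂μ = ∫ ω, (D ω).trace ∂μ := by
  have hexpand (ω : Ω) :
      X ω ⬝ᵥ D ω *ᵥ X ω = ∑ a, ∑ b, (X ω a * X ω b) * D ω a b := by
    simp only [dotProduct, mulVec, Finset.mul_sum]
    exact Finset.sum_congr rfl fun a _ => Finset.sum_congr rfl fun b _ => by ring
  have hentry (a b : ι) : IndepFun (fun ω => X ω a * X ω b) (fun ω => D ω a b) μ :=
    (hind a b).comp (by fun_prop : Measurable fun x : ι → ℝ => x a * x b) measurable_id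
  have hint (a b : ι) : Integrable (fun ω => (X ω a * X ω b) * D ω a b) μ :=
    (hentry a b).integrable_mul (hX.integrable_mul hXm a b) (hD a b)
  have hrow (a : ι) : Integrable (fun ω => ∑ b, (X ω a * X ω b) * D ω a b) μ :=
    integrable_finsetSum _ fun b _ => hint a b
  simp only [hexpand]
  refine ⟨integrable_finsetSum _ fun a _ => hrow a, ?_⟩
  have hprod (a b : ι) : ∫ ω, (X ω a * X ω b) * D ω a b ∂μ =
      (1 : Matrix ι ι ℝ) a b * ∫ ω, D ω a b ∂μ := by
    rw [← hX a b]
    exact (hentry a b).integral_fun_mul_eq_mul_integral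
      (hX.integrable_mul hXm a b).aestronglyMeasurable (hD a b).aestronglyMeasurable
  rw [integral_finsetSum _ fun a _ => hrow a]
  simp only [integral_finsetSum _ fun b _ => hint _ b, hprod, trace, diag_apply,
    integral_finsetSum _ fun a _ => hD a a, one_apply, ite_mul, one_mul, zero_mul,
    Finset.sum_ite_eq, Finset.mem_univ, if_true]

end Isotropic

section EssentiallyBounded

variable {ι Ω : Type*} [Fintype ι] [MeasurableSpace Ω] {μ : Measure Ω}

theorem memLp_top_apply_of_dotProduct_self_le {X : Ω → ι → ℝ} (hX : AEStronglyMeasurable X μ)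
    {L : ℝ} (hXL : ∀ᵐ ω ∂μ, X ω ⬝ᵥ X ω ≤ L) (a : ι) : MemLp (fun ω => X ω a) ⊤ μ := by
  refine memLp_top_of_bound ((continuous_apply a).comp_aestronglyMeasurable hX) (√L) ?_
  filter_upwards [hXL] with ω hω
  refine Real.abs_le_sqrt (le_trans ?_ hω)
  rw [sq]
  exact Finset.single_le_sum (f := fun i => X ω i * X ω i) (fun i _ => mul_self_nonneg _)
    (Finset.mem_univ a)

theorem memLp_top_pow_apply [DecidableEq ι] [IsFiniteMeasure μ] {D : Ω → Matrix ι ι ℝ}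
    (hD : ∀ a b, MemLp (fun ω => D ω a b) ⊤ μ) (N : ℕ) (a b : ι) :
    MemLp (fun ω => (D ω ^ N) a b) ⊤ μ := by
  induction N generalizing b with
  | zero => simpa only [pow_zero] using memLp_const _
  | succ N ih =>
    simp only [pow_succ, mul_apply]
    exact memLp_finsetSum _ fun i _ => (hD i b).mul (ih i)

end EssentiallyBounded

section MatrixChernoff

variable {ι κ : Type*} [DecidableEq ι]

/-- The matrix `1 - ε ∑_{j ∈ H} w_j w_jᵀ`. The trace of a high power of it is the potential of the
Chernoff argument, in the role of the matrix exponential `exp (-ε ∑_{j ∈ H} w_j w_jᵀ)`. -/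
def dampedMatrix (ε : ℝ) (H : Finset κ) (w : κ → ι → ℝ) : Matrix ι ι ℝ :=
  1 - ε • ∑ j ∈ H, vecMulVec (w j) (w j)

theorem dampedMatrix_insert [DecidableEq κ] (ε : ℝ) {H : Finset κ} {i : κ} (hi : i ∉ H)
    (w : κ → ι → ℝ) :
    dampedMatrix ε (insert i H) w = dampedMatrix ε H w - ε • vecMulVec (w i) (w i) := by
  rw [dampedMatrix, dampedMatrix, Finset.sum_insert hi, smul_add]
  abel

variable [Fintype ι]

theorem dotProduct_dampedMatrix_mulVec (ε : ℝ) (H : Finset κ) (w : κ → ι → ℝ) (v : ι → ℝ) :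
    v ⬝ᵥ dampedMatrix ε H w *ᵥ v = v ⬝ᵥ v - ε * ∑ j ∈ H, (w j ⬝ᵥ v) ^ 2 := by
  rw [dampedMatrix, sub_mulVec, dotProduct_sub, one_mulVec, smul_mulVec, dotProduct_smul,
    sum_mulVec, dotProduct_sum, smul_eq_mul]
  simp only [dotProduct_vecMulVec_mulVec]

theorem dotProduct_dampedMatrix_mulVec_le {ε : ℝ} (hε : 0 ≤ ε) (H : Finset κ) (w : κ → ι → ℝ)
    (v : ι → ℝ) : v ⬝ᵥ dampedMatrix ε H w *ᵥ v ≤ v ⬝ᵥ v := by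
  rw [dotProduct_dampedMatrix_mulVec]
  exact sub_le_self _ (mul_nonneg hε (Finset.sum_nonneg fun j _ => sq_nonneg _))

theorem le_dotProduct_dampedMatrix_mulVec {ε L s : ℝ} (hε : 0 ≤ ε) {H : Finset κ}
    (hs : H.card * ε * L ≤ s) {w : κ → ι → ℝ} (hw : ∀ j ∈ H, w j ⬝ᵥ w j ≤ L) (v : ι → ℝ) :
    (1 - s) * (v ⬝ᵥ v) ≤ v ⬝ᵥ dampedMatrix ε H w *ᵥ v := by
  have hv := dotProduct_self_nonneg v
  have hsum : ∑ j ∈ H, (w j ⬝ᵥ v) ^ 2 ≤ H.card * (L * (v ⬝ᵥ v)) :=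
    calc ∑ j ∈ H, (w j ⬝ᵥ v) ^ 2 ≤ ∑ _j ∈ H, L * (v ⬝ᵥ v) := Finset.sum_le_sum fun j hj =>
          (sq_dotProduct_le _ _).trans (mul_le_mul_of_nonneg_right (hw j hj) hv)
      _ = H.card * (L * (v ⬝ᵥ v)) := by rw [Finset.sum_const, nsmul_eq_mul]
  have hscaled : ε * ∑ j ∈ H, (w j ⬝ᵥ v) ^ 2 ≤ s * (v ⬝ᵥ v) :=
    calc ε * ∑ j ∈ H, (w j ⬝ᵥ v) ^ 2 ≤ ε * (H.card * (L * (v ⬝ᵥ v))) := by gcongr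
      _ = (H.card * ε * L) * (v ⬝ᵥ v) := by ring
      _ ≤ s * (v ⬝ᵥ v) := by gcongr
  rw [dotProduct_dampedMatrix_mulVec, sub_mul, one_mul]
  exact sub_le_sub_left hscaled _

theorem dampedMatrix_posSemidef {ε L : ℝ} (hε : 0 ≤ ε) {H : Finset κ}
    (hs : H.card * ε * L ≤ 1) {w : κ → ι → ℝ} (hw : ∀ j ∈ H, w j ⬝ᵥ w j ≤ L) :
    (dampedMatrix ε H w).PosSemidef := by
  refine .of_dotProduct_mulVec_nonneg ?_ fun v => ?_
  · rw [IsHermitian, dampedMatrix, conjTranspose_eq_transpose_of_trivial, transpose_sub,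
      transpose_one, transpose_smul, transpose_sum]
    simp only [transpose_vecMulVec]
  · simpa only [star_trivial, sub_self, zero_mul] using
      le_dotProduct_dampedMatrix_mulVec hε hs hw v

variable {Ω : Type*} [MeasurableSpace Ω] {μ : Measure Ω} {W : κ → Ω → ι → ℝ} {L : ℝ}

theorem indepFun_dampedMatrix_pow_apply (hW : ∀ j, Measurable (W j))
    (hind : iIndepFun W μ) (ε : ℝ) {H : Finset κ} {i : κ} (hi : i ∉ H) (N : ℕ) (a b : ι) :
    IndepFun (W i) (fun ω => (dampedMatrix ε H (fun j => W j ω) ^ N) a b) μ := by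
  have hcont : Continuous fun x : H → ι → ℝ => dampedMatrix ε Finset.univ x := by
    unfold dampedMatrix
    fun_prop
  have hcomp := (hind.indepFun_finset {i} H (by simpa using hi) hW).comp
    (measurable_pi_apply ⟨i, Finset.mem_singleton_self i⟩)
    (ψ := fun x => (dampedMatrix ε Finset.univ x ^ N) a b)
    ((hcont.pow N).matrix_elem a b).measurable
  have hrestrict (ω : Ω) :
      dampedMatrix ε Finset.univ (fun j : H => W j ω) = dampedMatrix ε H (fun j => W j ω) := by
    simp only [dampedMatrix, Finset.sum_coe_sort H fun j => vecMulVec (W j ω) (W j ω)]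
  simpa only [Function.comp_def, hrestrict] using hcomp

variable [IsProbabilityMeasure μ]

theorem integrable_dampedMatrix_pow_apply (hW : ∀ j, Measurable (W j))
    (hWL : ∀ j, ∀ᵐ ω ∂μ, W j ω ⬝ᵥ W j ω ≤ L) (ε : ℝ) (H : Finset κ) (N : ℕ) (a b : ι) :
    Integrable (fun ω => (dampedMatrix ε H (fun j => W j ω) ^ N) a b) μ := by
  have hW_top (j : κ) (c : ι) : MemLp (fun ω => W j ω c) ⊤ μ :=
    memLp_top_apply_of_dotProduct_self_le (hW j).aestronglyMeasurable (hWL j) c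
  have hentry (c e : ι) : MemLp (fun ω => dampedMatrix ε H (fun j => W j ω) c e) ⊤ μ := by
    simp only [dampedMatrix, Matrix.sub_apply, Matrix.smul_apply, Matrix.sum_apply,
      vecMulVec_apply]
    exact (memLp_const _).sub
      ((memLp_finsetSum _ fun j _ => (hW_top j e).mul (hW_top j c)).const_smul ε)
  exact (memLp_top_pow_apply hentry N a b).integrable le_top

theorem integrable_trace_dampedMatrix_pow (hW : ∀ j, Measurable (W j))
    (hWL : ∀ j, ∀ᵐ ω ∂μ, W j ω ⬝ᵥ W j ω ≤ L) (ε : ℝ) (H : Finset κ) (N : ℕ) :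
    Integrable (fun ω => (dampedMatrix ε H (fun j => W j ω) ^ N).trace) μ :=
  integrable_finsetSum _ fun a _ => integrable_dampedMatrix_pow_apply hW hWL ε H N a a

theorem integral_trace_dampedMatrix_insert_pow_le [DecidableEq κ] (hW : ∀ j, Measurable (W j))
    (hind : iIndepFun W μ) (hWL : ∀ j, ∀ᵐ ω ∂μ, W j ω ⬝ᵥ W j ω ≤ L)
    (hiso : ∀ j, Isotropic (W j) μ) {ε τ : ℝ} {N : ℕ} (hε : 0 ≤ ε) (hL : 0 ≤ L) (hτ : τ ≤ 1)
    (hN : N * ε * L ≤ τ / 3) {H : Finset κ} {i : κ} (hi : i ∉ H) (hH : H.card + 1 ≤ N) :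
    ∫ ω, (dampedMatrix ε (insert i H) (fun j => W j ω) ^ N).trace ∂μ ≤
      (1 - (1 - τ / 2) * ε * N) * ∫ ω, (dampedMatrix ε H (fun j => W j ω) ^ N).trace ∂μ := by
  obtain ⟨hform_int, hform⟩ := (hiso i).integral_dotProduct_mulVec (hW i).aestronglyMeasurable
    (integrable_dampedMatrix_pow_apply hW hWL ε H N)
    (indepFun_dampedMatrix_pow_apply hW hind ε hi N)
  have htrace_int := fun H => integrable_trace_dampedMatrix_pow hW hWL ε H N
  have hcard {G : Finset κ} (hG : G.card ≤ N) : G.card * ε * L ≤ τ / 3 := hN.trans' (by gcongr)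
  have hinsert : (insert i H).card ≤ N := by rwa [Finset.card_insert_of_notMem hi]
  calc ∫ ω, (dampedMatrix ε (insert i H) (fun j => W j ω) ^ N).trace ∂μ
      ≤ ∫ ω, ((dampedMatrix ε H (fun j => W j ω) ^ N).trace - (1 - τ / 2) * ε * N *
          (W i ω ⬝ᵥ (dampedMatrix ε H (fun j => W j ω) ^ N) *ᵥ W i ω)) ∂μ := by
        refine integral_mono_ae (htrace_int _) ((htrace_int _).sub (hform_int.const_mul _)) ?_
        filter_upwards [(Finset.eventually_all (insert i H)).2 fun j _ => hWL j] with ω hω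
        have hω' : ∀ j ∈ H, W j ω ⬝ᵥ W j ω ≤ L := fun j hj => hω j (Finset.mem_insert_of_mem hj)
        refine trace_pow_sub_vecMulVec_le (a := 1 - τ / 3) (dampedMatrix_insert ε hi _)
          (dampedMatrix_posSemidef hε ((hcard (by omega)).trans (by linarith)) hω')
          (dampedMatrix_posSemidef hε ((hcard hinsert).trans (by linarith)) hω) hε (by linarith)
          (by linarith) (le_dotProduct_dampedMatrix_mulVec hε (hcard (by omega)) hω')
          (dotProduct_dampedMatrix_mulVec_le hε H _) ?_
        have hWi : N * ε * (W i ω ⬝ᵥ W i ω) ≤ N * ε * L := by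
          gcongr
          exact hω i (Finset.mem_insert_self i H)
        rw [div_le_iff₀ (by linarith)]
        have hmass : 0 ≤ N * ε * L := by positivity
        nlinarith
    _ = (1 - (1 - τ / 2) * ε * N) * ∫ ω, (dampedMatrix ε H (fun j => W j ω) ^ N).trace ∂μ := by
        rw [integral_sub (htrace_int _) (hform_int.const_mul _), integral_const_mul, hform]
        ring

theorem integral_trace_dampedMatrix_pow_le (hW : ∀ j, Measurable (W j)) (hind : iIndepFun W μ)
    (hWL : ∀ j, ∀ᵐ ω ∂μ, W j ω ⬝ᵥ W j ω ≤ L) (hiso : ∀ j, Isotropic (W j) μ) {ε τ : ℝ} {N : ℕ}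
    (hε : 0 ≤ ε) (hL : 1 ≤ L) (hτ : τ ≤ 1) (hN : N * ε * L ≤ τ / 3) {H : Finset κ}
    (hH : H.card ≤ N) :
    ∫ ω, (dampedMatrix ε H (fun j => W j ω) ^ N).trace ∂μ ≤
      Fintype.card ι * (1 - (1 - τ / 2) * ε * N) ^ H.card := by
  classical
  have hρ : 0 ≤ 1 - (1 - τ / 2) * ε * N := by
    have hmass : N * ε ≤ τ / 3 := hN.trans' (le_mul_of_one_le_right (by positivity) hL)
    have hmass0 : 0 ≤ N * ε := by positivity
    nlinarith [hmass, hmass0]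
  induction H using Finset.induction_on with
  | empty => simp [dampedMatrix]
  | insert i H hi ih =>
    rw [Finset.card_insert_of_notMem hi] at hH ⊢
    calc ∫ ω, (dampedMatrix ε (insert i H) (fun j => W j ω) ^ N).trace ∂μ
        ≤ (1 - (1 - τ / 2) * ε * N) * ∫ ω, (dampedMatrix ε H (fun j => W j ω) ^ N).trace ∂μ :=
          integral_trace_dampedMatrix_insert_pow_le hW hind hWL hiso hε (by linarith) hτ hN hi hH
      _ ≤ (1 - (1 - τ / 2) * ε * N) *
            (Fintype.card ι * (1 - (1 - τ / 2) * ε * N) ^ H.card) :=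
          mul_le_mul_of_nonneg_left (ih (by omega)) hρ
      _ = Fintype.card ι * (1 - (1 - τ / 2) * ε * N) ^ (H.card + 1) := by ring

/-- The left side is the decay of the expected trace per summand and `1 - (1 - τ) * u` is the
threshold in Markov's inequality, so the exponential is the gain per summand. -/
theorem one_sub_mul_le_mul_exp {τ u : ℝ} (hτ0 : 0 ≤ τ) (hτ1 : τ ≤ 1) (hu0 : 0 ≤ u) (hu1 : u ≤ 1) :
    1 - (1 - τ / 2) * u ≤ (1 - (1 - τ) * u) * Real.exp (-(τ * u / 2)) :=
  calc 1 - (1 - τ / 2) * u ≤ (1 - (1 - τ) * u) * (-(τ * u / 2) + 1) := by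
        have : 0 ≤ (1 - τ) * τ * u ^ 2 := by
          have := sub_nonneg.2 hτ1
          positivity
        linarith
    _ ≤ (1 - (1 - τ) * u) * Real.exp (-(τ * u / 2)) := by
        have : (1 - τ) * u ≤ 1 := by nlinarith
        exact mul_le_mul_of_nonneg_left (Real.add_one_le_exp _) (by linarith)

theorem pow_le_trace_dampedMatrix_pow {ε τ : ℝ} (hε : 0 < ε) {H : Finset κ}
    (hs : H.card * ε * L ≤ 1) {w : κ → ι → ℝ} (hw : ∀ j ∈ H, w j ⬝ᵥ w j ≤ L)
    (hτ : 0 ≤ 1 - (1 - τ) * (H.card * ε)) {v : ι → ℝ}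
    (hv : ∑ j ∈ H, (w j ⬝ᵥ v) ^ 2 < (1 - τ) * H.card * (v ⬝ᵥ v)) (N : ℕ) :
    (1 - (1 - τ) * (H.card * ε)) ^ N ≤ (dampedMatrix ε H w ^ N).trace := by
  refine pow_le_trace_pow (dampedMatrix_posSemidef hε.le hs hw) hτ (v := v) ?_ N
  rw [dotProduct_dampedMatrix_mulVec]
  linarith [mul_lt_mul_of_pos_left hv hε]

theorem pow_mul_measureReal_exists_lt_le_integral_trace (hW : ∀ j, Measurable (W j))
    (hWL : ∀ j, ∀ᵐ ω ∂μ, W j ω ⬝ᵥ W j ω ≤ L) {ε τ : ℝ} (hε : 0 < ε) {H : Finset κ}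
    (hs : H.card * ε * L ≤ 1) (hτ : 0 ≤ 1 - (1 - τ) * (H.card * ε)) (N : ℕ) :
    (1 - (1 - τ) * (H.card * ε)) ^ N *
        μ.real {ω | ∃ v, ∑ j ∈ H, (W j ω ⬝ᵥ v) ^ 2 < (1 - τ) * H.card * (v ⬝ᵥ v)} ≤
      ∫ ω, (dampedMatrix ε H (fun j => W j ω) ^ N).trace ∂μ := by
  have hbounded : ∀ᵐ ω ∂μ, ∀ j ∈ H, W j ω ⬝ᵥ W j ω ≤ L :=
    (Finset.eventually_all H).2 fun j _ => hWL j
  have hnonneg : 0 ≤ᵐ[μ] fun ω => (dampedMatrix ε H (fun j => W j ω) ^ N).trace := by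
    filter_upwards [hbounded] with ω hω
    exact ((dampedMatrix_posSemidef hε.le hs hω).pow N).trace_nonneg
  refine le_trans (mul_le_mul_of_nonneg_left ?_ (pow_nonneg hτ N))
    (mul_meas_ge_le_integral_of_nonneg hnonneg (integrable_trace_dampedMatrix_pow hW hWL ε H N)
      ((1 - (1 - τ) * (H.card * ε)) ^ N))
  refine ENNReal.toReal_mono (measure_ne_top _ _) (measure_mono_ae ?_)
  filter_upwards [hbounded] with ω hω
  rintro ⟨v, hv⟩
  exact pow_le_trace_dampedMatrix_pow hε hs hω hτ hv N

theorem measure_exists_sum_sq_dotProduct_lt_le (hW : ∀ j, Measurable (W j)) (hind : iIndepFun W μ)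
    (hWL : ∀ j, ∀ᵐ ω ∂μ, W j ω ⬝ᵥ W j ω ≤ L) (hiso : ∀ j, Isotropic (W j) μ) {τ : ℝ}
    (hτ0 : 0 < τ) (hτ1 : τ ≤ 1) (H : Finset κ) :
    μ {ω | ∃ v : ι → ℝ, ∑ j ∈ H, (W j ω ⬝ᵥ v) ^ 2 < (1 - τ) * H.card * (v ⬝ᵥ v)} ≤
      ENNReal.ofReal (Fintype.card ι * Real.exp (-(τ ^ 2 * H.card / (6 * L)))) := by
  rcases H.eq_empty_or_nonempty with rfl | ⟨j₀, hj₀⟩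
  · simp
  rcases isEmpty_or_nonempty ι with hι | hι
  · simp
  set h := H.card
  have hh0 : (0 : ℝ) < h := by exact_mod_cast Finset.card_pos.2 ⟨j₀, hj₀⟩
  have hL : 1 ≤ L := le_trans (by exact_mod_cast Fintype.card_pos) ((hiso j₀).card_le (hWL j₀))
  obtain ⟨ε, hε0, hε⟩ : ∃ ε > 0, h * ε * L = τ / 3 :=
    ⟨τ / (3 * h * L), by positivity, by field_simp⟩
  set u := h * ε with hu
  have hu0 : 0 < u := by positivity
  have hu1 : u ≤ 1 := by nlinarith
  set a := 1 - (1 - τ) * u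
  have ha0 : 0 < a := by nlinarith
  rw [← ofReal_measureReal]
  refine ENNReal.ofReal_le_ofReal (le_of_mul_le_mul_left ?_ (pow_pos ha0 h))
  calc a ^ h * μ.real {ω | ∃ v : ι → ℝ, ∑ j ∈ H, (W j ω ⬝ᵥ v) ^ 2 < (1 - τ) * h * (v ⬝ᵥ v)}
      ≤ ∫ ω, (dampedMatrix ε H (fun j => W j ω) ^ h).trace ∂μ :=
        pow_mul_measureReal_exists_lt_le_integral_trace hW hWL hε0 (by linarith) ha0.le h
    _ ≤ Fintype.card ι * (1 - (1 - τ / 2) * ε * h) ^ h :=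
        integral_trace_dampedMatrix_pow_le hW hind hWL hiso hε0.le hL hτ1 hε.le le_rfl
    _ ≤ Fintype.card ι * (a * Real.exp (-(τ * u / 2))) ^ h := by
        have hle := one_sub_mul_le_mul_exp hτ0.le hτ1 hu0.le hu1
        have hρ : (1 - τ / 2) * ε * h = (1 - τ / 2) * u := by rw [hu]; ring
        rw [hρ]
        gcongr
        nlinarith
    _ = a ^ h * (Fintype.card ι * Real.exp (-(τ ^ 2 * h / (6 * L)))) := by
        have hexponent : h * -(τ * u / 2) = -(τ ^ 2 * h / (6 * L)) := by
          field_simp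
          linear_combination (-6) * hε
        rw [mul_pow, ← Real.exp_nat_mul, hexponent]
        ring

end MatrixChernoff

variable {d : ℕ}

section Whitening

variable {A B : Matrix (Fin d) (Fin d) ℝ}

theorem cfc_apply_eq_sum (hA : A.IsHermitian) (f : ℝ → ℝ) (i j : Fin d) :
    cfc f A i j = ∑ l, (hA.eigenvectorUnitary : Matrix (Fin d) (Fin d) ℝ) i l *
      f (hA.eigenvalues l) * (hA.eigenvectorUnitary : Matrix (Fin d) (Fin d) ℝ) j l := by
  rw [hA.cfc_eq, IsHermitian.cfc, Unitary.conjStarAlgAut_apply, mul_apply]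
  simp [mul_diagonal]

/-- The matrix whose rows are the eigenvectors of `A` for its nonzero eigenvalues `l`, each
multiplied by `f l`. -/
noncomputable def spectralRows (hA : A.IsHermitian) (f : ℝ → ℝ) :
    Matrix {l : Fin d // hA.eigenvalues l ≠ 0} (Fin d) ℝ :=
  of fun l j => f (hA.eigenvalues l) * (hA.eigenvectorUnitary : Matrix (Fin d) (Fin d) ℝ) j l

theorem transpose_spectralRows_mul (hA : A.IsHermitian) {f g : ℝ → ℝ} (hfg : f 0 * g 0 = 0) :
    (spectralRows hA f)ᵀ * spectralRows hA g = cfc (fun x => f x * g x) A := by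
  ext i j
  set U := (hA.eigenvectorUnitary : Matrix (Fin d) (Fin d) ℝ)
  set F : Fin d → ℝ := fun l => U i l * (f (hA.eigenvalues l) * g (hA.eigenvalues l)) * U j l
  calc ((spectralRows hA f)ᵀ * spectralRows hA g) i j
      = ∑ l : {l // hA.eigenvalues l ≠ 0}, F l := by
        rw [mul_apply]
        exact Finset.sum_congr rfl fun l _ => by
          simp only [spectralRows, transpose_apply, of_apply, F, U]; ring
    _ = ∑ l with hA.eigenvalues l ≠ 0, F l := (Finset.sum_subtype _ (by simp) F).symm
    _ = ∑ l, F l := Finset.sum_filter_of_ne fun l _ hFl hl => hFl (by simp [F, hl, hfg])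
    _ = cfc (fun x => f x * g x) A i j :=
        (cfc_apply_eq_sum hA (fun x => f x * g x) i j).symm

theorem spectralRows_mul_transpose (hA : A.IsHermitian) (f g : ℝ → ℝ) :
    spectralRows hA f * (spectralRows hA g)ᵀ =
      diagonal fun l : {l // hA.eigenvalues l ≠ 0} =>
        f (hA.eigenvalues l) * g (hA.eigenvalues l) := by
  ext a b
  set U := (hA.eigenvectorUnitary : Matrix (Fin d) (Fin d) ℝ) with hU
  have hUU : ∑ l, U l a * U l b = (1 : Matrix (Fin d) (Fin d) ℝ) a b := by
    have hstar : star U * U = 1 := by rw [hU]; exact Unitary.coe_star_mul_self _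
    simpa only [mul_apply, star_eq_conjTranspose, conjTranspose_apply, star_trivial] using
      congrFun (congrFun hstar a) b
  calc (spectralRows hA f * (spectralRows hA g)ᵀ) a b
      = f (hA.eigenvalues a) * g (hA.eigenvalues b) * ∑ l, U l a * U l b := by
        rw [mul_apply, Finset.mul_sum]
        exact Finset.sum_congr rfl fun l _ => by
          simp only [spectralRows, transpose_apply, of_apply, U]; ring
    _ = diagonal (fun l : {l // hA.eigenvalues l ≠ 0} =>
          f (hA.eigenvalues l) * g (hA.eigenvalues l)) a b := by
        rw [hUU, one_apply, diagonal_apply]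
        by_cases hab : a = b
        · subst hab; simp
        · simp [hab, Subtype.ext_iff.not.1 hab]

variable {ι : Type*} [Fintype ι] {S T : Matrix ι (Fin d) ℝ}

theorem dotProduct_mulVec_eq_of_transpose_mulVec_mulVec_eq {z : Fin d → ℝ}
    (hz : Tᵀ *ᵥ (S *ᵥ z) = z) (v : Fin d → ℝ) : (S *ᵥ z) ⬝ᵥ (T *ᵥ v) = z ⬝ᵥ v := by
  rw [dotProduct_mulVec, ← mulVec_transpose, hz]

variable [DecidableEq ι]

/-- The matrices `S` and `T` are coordinates on the range of `A` in which `A` becomes the identity: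
`z ↦ S z` whitens the vectors of the range and `x ↦ Tᵀ x` inverts it. In contrast to `A^{-1/2}`, the
index type `ι` has as many elements as the rank of `A`. -/
structure IsWhitening (A : Matrix (Fin d) (Fin d) ℝ) (S T : Matrix ι (Fin d) ℝ) : Prop where
  pinv_eq : Sᵀ * S = pinv A
  self_eq : Tᵀ * T = A
  mul_transpose : T * Sᵀ = 1

theorem isWhitening_spectralRows (hA : A.PosSemidef) :
    IsWhitening A (spectralRows hA.isHermitian fun x => (√x)⁻¹)
      (spectralRows hA.isHermitian fun x => √x) := by
  have hspec : ∀ x ∈ spectrum ℝ A, 0 ≤ x := by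
    rw [hA.isHermitian.spectrum_real_eq_range_eigenvalues, Set.forall_mem_range]
    exact hA.eigenvalues_nonneg
  refine ⟨?_, ?_, ?_⟩
  · rw [transpose_spectralRows_mul _ (by simp)]
    exact cfc_congr fun x hx => by rw [← mul_inv, Real.mul_self_sqrt (hspec x hx)]
  · rw [transpose_spectralRows_mul _ (by simp)]
    exact (cfc_congr fun x hx => Real.mul_self_sqrt (hspec x hx)).trans (cfc_id' ℝ A hA.isHermitian)
  · rw [spectralRows_mul_transpose, ← diagonal_one]
    congr 1
    exact funext fun l => mul_inv_cancel₀
      (Real.sqrt_ne_zero'.2 ((hA.eigenvalues_nonneg l).lt_of_ne' l.2))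

namespace IsWhitening

theorem card_eq_rank (hST : IsWhitening A S T) : Fintype.card ι = A.rank := by
  rw [← hST.self_eq, rank_transpose_mul_self]
  refine le_antisymm ?_ T.rank_le_card_height
  calc Fintype.card ι = (T * Sᵀ).rank := by rw [hST.mul_transpose, rank_one]
    _ ≤ T.rank := rank_mul_le_left T Sᵀ

theorem dotProduct_pinv_mulVec (hST : IsWhitening A S T) (z : Fin d → ℝ) :
    z ⬝ᵥ pinv A *ᵥ z = (S *ᵥ z) ⬝ᵥ (S *ᵥ z) := by
  rw [← hST.pinv_eq, ← mulVec_mulVec, dotProduct_mulVec, vecMul_transpose]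

theorem dotProduct_mulVec (hST : IsWhitening A S T) (v : Fin d → ℝ) :
    v ⬝ᵥ A *ᵥ v = (T *ᵥ v) ⬝ᵥ (T *ᵥ v) := by
  rw [← hST.self_eq, ← mulVec_mulVec, Matrix.dotProduct_mulVec, vecMul_transpose]

theorem psdNorm_eq (hST : IsWhitening A S T) (z : Fin d → ℝ) :
    psdNorm A z = √((S *ᵥ z) ⬝ᵥ (S *ᵥ z)) := by
  rw [psdNorm, hST.dotProduct_pinv_mulVec]

theorem row_dotProduct_mulVec_row (hST : IsWhitening A S T) (a b : ι) :
    S.row a ⬝ᵥ A *ᵥ S.row b = (1 : Matrix ι ι ℝ) a b := by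
  have hconj : S * A * Sᵀ = 1 :=
    calc S * A * Sᵀ = (T * Sᵀ)ᵀ * (T * Sᵀ) := by
          rw [← hST.self_eq, transpose_mul, transpose_transpose]
          simp only [Matrix.mul_assoc]
      _ = 1 := by rw [hST.mul_transpose, transpose_one, Matrix.one_mul]
  rw [← hconj, Matrix.mul_assoc]
  rfl

end IsWhitening

theorem pinv_mulVec_dotProduct_mulVec_pinv_mulVec (hA : A.IsHermitian) (z : Fin d → ℝ) :
    (pinv A *ᵥ z) ⬝ᵥ A *ᵥ (pinv A *ᵥ z) = z ⬝ᵥ pinv A *ᵥ z := by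
  have hsymm : (pinv A)ᵀ = pinv A := by
    have hherm : (pinv A).IsHermitian := cfc_predicate (R := ℝ) (fun x : ℝ => x⁻¹) A
    simpa using hherm.eq
  calc (pinv A *ᵥ z) ⬝ᵥ A *ᵥ (pinv A *ᵥ z) = ((pinv A)ᵀ *ᵥ z) ⬝ᵥ A *ᵥ (pinv A *ᵥ z) := by rw [hsymm]
    _ = z ⬝ᵥ (pinv A * A * pinv A) *ᵥ z := by
        rw [mulVec_transpose, ← dotProduct_mulVec, mulVec_mulVec, mulVec_mulVec]
    _ = z ⬝ᵥ pinv A *ᵥ z := by rw [(pinv_penrose A hA).2.1]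

theorem psdNorm_sq (hA : A.PosSemidef) (z : Fin d → ℝ) :
    psdNorm A z ^ 2 = z ⬝ᵥ pinv A *ᵥ z := by
  have hST := isWhitening_spectralRows hA
  rw [hST.psdNorm_eq, hST.dotProduct_pinv_mulVec, Real.sq_sqrt (dotProduct_self_nonneg _)]

/-- Matrix inversion is antitone in the Loewner order; for pseudoinverses this persists on the range
of the smaller matrix. -/
theorem IsWhitening.dotProduct_pinv_mulVec_le (hST : IsWhitening A S T) (hB : B.IsHermitian)
    {c : ℝ} (hc : 0 ≤ c) (hAB : ∀ v, v ⬝ᵥ A *ᵥ v ≤ c * (v ⬝ᵥ B *ᵥ v)) {z : Fin d → ℝ}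
    (hz : Tᵀ *ᵥ (S *ᵥ z) = z) : z ⬝ᵥ pinv B *ᵥ z ≤ c * (z ⬝ᵥ pinv A *ᵥ z) := by
  set w := pinv B *ᵥ z
  have hzA : 0 ≤ z ⬝ᵥ pinv A *ᵥ z := by
    rw [hST.dotProduct_pinv_mulVec]
    exact dotProduct_self_nonneg _
  have hwA : w ⬝ᵥ A *ᵥ w ≤ c * (z ⬝ᵥ w) := by
    rw [← pinv_mulVec_dotProduct_mulVec_pinv_mulVec hB]
    exact hAB w
  have hsq : (z ⬝ᵥ w) ^ 2 ≤ (z ⬝ᵥ pinv A *ᵥ z) * (w ⬝ᵥ A *ᵥ w) := by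
    rw [← dotProduct_mulVec_eq_of_transpose_mulVec_mulVec_eq hz w, hST.dotProduct_pinv_mulVec,
      hST.dotProduct_mulVec]
    exact sq_dotProduct_le _ _
  by_contra! hlt
  have hpos : 0 < z ⬝ᵥ w := (mul_nonneg hc hzA).trans_lt hlt
  nlinarith [mul_le_mul_of_nonneg_left hwA hzA]

end Whitening

section SecondMoment

variable {P : Measure (Fin d → ℝ)}

theorem memLp_dotProduct {p : ENNReal} (hP : MemLp (fun z : Fin d → ℝ => z) p P)
    (v : Fin d → ℝ) : MemLp (fun z => v ⬝ᵥ z) p P :=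
  memLp_finsetSum _ fun i _ => (hP.eval i).const_mul (v i)

theorem dotProduct_secondMoment_mulVec (hP : MemLp (fun z : Fin d → ℝ => z) 2 P)
    (v w : Fin d → ℝ) : v ⬝ᵥ secondMoment P *ᵥ w = ∫ z, (v ⬝ᵥ z) * (w ⬝ᵥ z) ∂P := by
  have hint (i j : Fin d) : Integrable (fun z : Fin d → ℝ => v i * w j * (z i * z j)) P :=
    ((hP.eval i).integrable_mul (hP.eval j)).const_mul _
  calc v ⬝ᵥ secondMoment P *ᵥ w = ∑ i, ∑ j, v i * w j * ∫ z, z i * z j ∂P := by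
        simp only [dotProduct, mulVec, secondMoment, of_apply, Finset.mul_sum]
        exact Finset.sum_congr rfl fun i _ => Finset.sum_congr rfl fun j _ => by ring
    _ = ∫ z, ∑ i, ∑ j, v i * w j * (z i * z j) ∂P := by
        rw [integral_finsetSum _ fun i _ => integrable_finsetSum _ fun j _ => hint i j]
        simp only [integral_finsetSum _ fun j _ => hint _ j, integral_const_mul]
    _ = ∫ z, (v ⬝ᵥ z) * (w ⬝ᵥ z) ∂P := by
        simp only [dotProduct, Finset.sum_mul_sum, mul_mul_mul_comm]

theorem dotProduct_secondMoment_mulVec_self (hP : MemLp (fun z : Fin d → ℝ => z) 2 P)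
    (v : Fin d → ℝ) : v ⬝ᵥ secondMoment P *ᵥ v = ∫ z, (v ⬝ᵥ z) ^ 2 ∂P := by
  simp only [dotProduct_secondMoment_mulVec hP, sq]

theorem secondMoment_isHermitian (P : Measure (Fin d → ℝ)) : (secondMoment P).IsHermitian := by
  ext i j
  simp [secondMoment, mul_comm]

theorem secondMoment_posSemidef (hP : MemLp (fun z : Fin d → ℝ => z) 2 P) :
    (secondMoment P).PosSemidef :=
  .of_dotProduct_mulVec_nonneg (secondMoment_isHermitian P) fun v => by
    rw [star_trivial, dotProduct_secondMoment_mulVec_self hP]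
    exact integral_nonneg fun z => sq_nonneg _

variable {ι : Type*} [Fintype ι] [DecidableEq ι] {S T : Matrix ι (Fin d) ℝ}

/-- Almost every vector lies in the range of the second-moment matrix: its component along a
kernel vector `u` has second moment `u ⬝ᵥ secondMoment P *ᵥ u = 0`. -/
theorem IsWhitening.ae_transpose_mulVec_mulVec_eq (hST : IsWhitening (secondMoment P) S T)
    (hP : MemLp (fun z : Fin d → ℝ => z) 2 P) : ∀ᵐ z ∂P, Tᵀ *ᵥ (S *ᵥ z) = z := by
  have hcoord (j : Fin d) : ∀ᵐ z ∂P, (Tᵀ *ᵥ (S *ᵥ z)) j = z j := by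
    set u : Fin d → ℝ := Pi.single j 1 - Sᵀ *ᵥ (T *ᵥ Pi.single j 1) with hu
    have hTu : T *ᵥ u = 0 := by
      rw [hu, mulVec_sub, mulVec_mulVec _ T, hST.mul_transpose, one_mulVec, sub_self]
    have hnull : ∫ z, (u ⬝ᵥ z) ^ 2 ∂P = 0 := by
      rw [← dotProduct_secondMoment_mulVec_self hP, hST.dotProduct_mulVec, hTu, zero_dotProduct]
    rw [integral_eq_zero_iff_of_nonneg (fun z => sq_nonneg _)
      (memLp_dotProduct hP u).integrable_sq] at hnull
    filter_upwards [hnull] with z hz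
    have huz : u ⬝ᵥ z = 0 := pow_eq_zero_iff two_ne_zero |>.1 hz
    rw [hu, sub_dotProduct, mulVec_transpose, ← Matrix.dotProduct_mulVec, ← vecMul_transpose,
      ← Matrix.dotProduct_mulVec, single_one_dotProduct, single_one_dotProduct] at huz
    exact (sub_eq_zero.1 huz).symm
  filter_upwards [ae_all_iff.2 hcoord] with z hz using funext hz

theorem IsWhitening.isotropic (hST : IsWhitening (secondMoment P) S T)
    (hP : MemLp (fun z : Fin d → ℝ => z) 2 P) : Isotropic (fun z => S *ᵥ z) P := fun a b => by
  rw [← hST.row_dotProduct_mulVec_row, dotProduct_secondMoment_mulVec hP]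
  rfl

theorem rank_secondMoment_le [IsProbabilityMeasure P] (hP : MemLp (fun z : Fin d → ℝ => z) 2 P)
    {L : ℝ} (hPL : ∀ᵐ z ∂P, z ⬝ᵥ pinv (secondMoment P) *ᵥ z ≤ L) :
    (secondMoment P).rank ≤ L := by
  have hST := isWhitening_spectralRows (secondMoment_posSemidef hP)
  rw [← hST.card_eq_rank]
  exact (hST.isotropic hP).card_le (by simpa only [hST.dotProduct_pinv_mulVec] using hPL)

end SecondMoment

section SampleCovariance

variable {n : ℕ}

theorem dotProduct_scov_mulVec (z : Fin n → Fin d → ℝ) (H : Finset (Fin n)) (v : Fin d → ℝ) :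
    v ⬝ᵥ scov z H *ᵥ v = (∑ j ∈ H, (z j ⬝ᵥ v) ^ 2) / n := by
  rw [scov, smul_mulVec, dotProduct_smul, sum_mulVec, dotProduct_sum, smul_eq_mul,
    one_div_mul_eq_div]
  simp only [dotProduct_vecMulVec_mulVec]

theorem scov_isHermitian (z : Fin n → Fin d → ℝ) (H : Finset (Fin n)) :
    (scov z H).IsHermitian := by
  rw [scov, IsHermitian, conjTranspose_eq_transpose_of_trivial, transpose_smul, transpose_sum]
  simp only [transpose_vecMulVec]

variable {Ω : Type*} [MeasurableSpace Ω] {μ : Measure Ω} {P : Measure (Fin d → ℝ)}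
  {Z : Fin n → Ω → Fin d → ℝ}

theorem IsIIDSample.comp (hZ : IsIIDSample Z P μ) {c : (Fin d → ℝ) → Fin d → ℝ}
    (hc : Measurable c) : IsIIDSample (fun i ω => c (Z i ω)) (P.map c) μ :=
  ⟨fun i => hc.comp (hZ.1 i),
    fun i => by rw [← hZ.2.1 i, Measure.map_map hc (hZ.1 i)]; rfl,
    hZ.2.2.comp _ fun _ => hc⟩

theorem IsIIDSample.ae (hZ : IsIIDSample Z P μ) {p : (Fin d → ℝ) → Prop} (hp : ∀ᵐ z ∂P, p z) :
    ∀ᵐ ω ∂μ, ∀ i, p (Z i ω) :=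
  ae_all_iff.2 fun i => ae_of_ae_map (hZ.1 i).aemeasurable ((hZ.2.1 i).symm ▸ hp)

theorem IsIIDSample.isotropic (hZ : IsIIDSample Z P μ) {ι : Type*} [DecidableEq ι]
    {X : (Fin d → ℝ) → ι → ℝ} (hXc : Continuous X) (hX : Isotropic X P) (j : Fin n) :
    Isotropic (X ∘ Z j) μ := fun a b => by
  rw [← hX a b, ← hZ.2.1 j, integral_map (hZ.1 j).aemeasurable]
  · rfl
  · exact (by fun_prop : Continuous fun z => X z a * X z b).aestronglyMeasurable

theorem IsIIDSample.measure_exists_scov_lt_le [IsProbabilityMeasure μ] (hZ : IsIIDSample Z P μ)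
    (hP : MemLp (fun z : Fin d → ℝ => z) 2 P) {L : ℝ}
    (hPL : ∀ᵐ z ∂P, z ⬝ᵥ pinv (secondMoment P) *ᵥ z ≤ L) {τ : ℝ} (hτ0 : 0 < τ) (hτ1 : τ ≤ 1)
    (H : Finset (Fin n)) :
    μ {ω | ∃ v, v ⬝ᵥ scov (fun i => Z i ω) H *ᵥ v <
        (1 - τ) * (H.card / n) * (v ⬝ᵥ secondMoment P *ᵥ v)} ≤
      ENNReal.ofReal ((secondMoment P).rank * Real.exp (-(τ ^ 2 * H.card / (6 * L)))) := by
  have hST := isWhitening_spectralRows (secondMoment_posSemidef hP)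
  set S := spectralRows (secondMoment_posSemidef hP).isHermitian fun x => (√x)⁻¹
  set T := spectralRows (secondMoment_posSemidef hP).isHermitian fun x => √x
  have hS : Continuous fun z : Fin d → ℝ => S *ᵥ z := by fun_prop
  simp only [hST.dotProduct_pinv_mulVec] at hPL
  rw [← hST.card_eq_rank]
  refine le_trans (measure_mono_ae ?_) (measure_exists_sum_sq_dotProduct_lt_le
    (fun j => hS.measurable.comp (hZ.1 j)) (hZ.2.2.comp _ fun _ => hS.measurable)
    (fun j => (hZ.ae hPL).mono fun ω hω => hω j)
    (fun j => hZ.isotropic hS (hST.isotropic hP) j) hτ0 hτ1 H)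
  filter_upwards [hZ.ae (hST.ae_transpose_mulVec_mulVec_eq hP)] with ω hrange
  rintro ⟨v, hv⟩
  refine ⟨T *ᵥ v, ?_⟩
  rcases n.eq_zero_or_pos with rfl | hn
  · simp [dotProduct_scov_mulVec] at hv
  rw [dotProduct_scov_mulVec, mul_div_assoc', div_mul_eq_mul_div,
    div_lt_div_iff_of_pos_right (by exact_mod_cast hn), hST.dotProduct_mulVec] at hv
  simpa only [Function.comp_apply, dotProduct_mulVec_eq_of_transpose_mulVec_mulVec_eq (hrange _)]
    using hv

theorem card_firstHalf (n : ℕ) : (firstHalf n).card = n / 2 := by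
  rw [firstHalf, Fin.card_filter_val_lt]
  omega

theorem card_secondHalf (n : ℕ) : (secondHalf n).card = n - n / 2 := by
  have hcompl : secondHalf n = (firstHalf n)ᶜ := by
    ext i
    simp [secondHalf, firstHalf]
  rw [hcompl, Finset.card_compl, Fintype.card_fin, card_firstHalf]

end SampleCovariance

variable {P : Measure (Fin d → ℝ)}

section NormBounded

theorem mul_exp_neg_le {D N c δ : ℝ} (hD : 0 < D) (hδ : 0 < δ) (hc : 0 < c)
    (hN : c * Real.log (D / δ) ≤ N) : D * Real.exp (-(N / c)) ≤ δ :=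
  calc D * Real.exp (-(N / c)) ≤ D * Real.exp (-Real.log (D / δ)) := by
        gcongr
        rwa [le_div_iff₀' hc]
    _ = δ := by
        rw [Real.exp_neg, Real.exp_log (by positivity)]
        field_simp

theorem IsWhitening.normBounded {n : ℕ} {z : Fin n → Fin d → ℝ} {ι : Type*} [Fintype ι]
    [DecidableEq ι] {A : Matrix (Fin d) (Fin d) ℝ} {S T : Matrix ι (Fin d) ℝ}
    (hST : IsWhitening A S T) {c L b : ℝ} (hc : 0 ≤ c) (hb : c * L ≤ b ^ 2)
    (hrange : ∀ i, Tᵀ *ᵥ (S *ᵥ z i) = z i) (hL : ∀ i, z i ⬝ᵥ pinv A *ᵥ z i ≤ L)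
    (hcov : ∀ H, H = firstHalf n ∨ H = secondHalf n →
      ∀ v, v ⬝ᵥ A *ᵥ v ≤ c * (v ⬝ᵥ scov z H *ᵥ v)) : NormBounded z b := fun H hH i =>
  calc z i ⬝ᵥ pinv (scov z H) *ᵥ z i ≤ c * (z i ⬝ᵥ pinv A *ᵥ z i) :=
        hST.dotProduct_pinv_mulVec_le (scov_isHermitian z H) hc (hcov H hH) (hrange i)
    _ ≤ c * L := mul_le_mul_of_nonneg_left (hL i) hc
    _ ≤ b ^ 2 := hb

variable [IsProbabilityMeasure P] {n : ℕ} {δ b : ℝ} {Ω : Type*} [MeasurableSpace Ω]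
  {μ : Measure Ω} [IsProbabilityMeasure μ] {Z : Fin n → Ω → Fin d → ℝ}

theorem IsIIDSample.measure_exists_scov_half_lt_le (hZ : IsIIDSample Z P μ) (hn : n ≠ 0)
    (hδ : 0 < δ) (hnb : 162 * b ^ 2 * Real.log (2 * (d : ℝ) / δ) ≤ n)
    (hP : MemLp (fun z : Fin d → ℝ => z) 2 P)
    (hPb : ∀ᵐ z ∂P, z ⬝ᵥ pinv (secondMoment P) *ᵥ z ≤ 3 / 2 * b ^ 2) {H : Finset (Fin n)}
    (hH : (H.card : ℝ) = n / 2) :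
    μ {ω | ∃ v, 3 * (v ⬝ᵥ scov (fun i => Z i ω) H *ᵥ v) < v ⬝ᵥ secondMoment P *ᵥ v} ≤
      ENNReal.ofReal δ := by
  have hn' : (n : ℝ) ≠ 0 := by exact_mod_cast hn
  have hhalf : (H.card : ℝ) / n = 1 / 2 := by rw [hH]; field_simp
  have hchernoff := hZ.measure_exists_scov_lt_le hP hPb (τ := 1 / 3) (by norm_num) (by norm_num) H
  rw [hhalf] at hchernoff
  refine le_trans (measure_mono ?_) (hchernoff.trans (ENNReal.ofReal_le_ofReal ?_))
  · exact fun ω ⟨v, hv⟩ => ⟨v, by linarith⟩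
  set r := (secondMoment P).rank
  rcases r.eq_zero_or_pos with hr | hr
  · simp [hr, hδ.le]
  have hrd : r ≤ d := (rank_le_card_height _).trans_eq (Fintype.card_fin d)
  have hrb : (r : ℝ) ≤ 3 / 2 * b ^ 2 := rank_secondMoment_le hP hPb
  have hr1 : (1 : ℝ) ≤ r := by exact_mod_cast hr
  have hd : (r : ℝ) ≤ d := by exact_mod_cast hrd
  have hb2 : 0 < b ^ 2 := by linarith
  have hexponent : (1 / 3) ^ 2 * (H.card : ℝ) / (6 * (3 / 2 * b ^ 2)) = n / (162 * b ^ 2) := by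
    rw [hH]
    field_simp
    norm_num
  calc r * Real.exp (-((1 / 3) ^ 2 * H.card / (6 * (3 / 2 * b ^ 2))))
      ≤ 2 * d * Real.exp (-(n / (162 * b ^ 2))) := by
        rw [hexponent]
        gcongr
        linarith
    _ ≤ δ := mul_exp_neg_le (by linarith) hδ (by positivity) hnb

theorem IsIIDSample.measure_not_normBounded_le (hZ : IsIIDSample Z P μ) (hn : Even n)
    (hδ : 0 < δ) (hnb : 162 * b ^ 2 * Real.log (2 * (d : ℝ) / δ) ≤ n)
    (hP : MemLp (fun z : Fin d → ℝ => z) 2 P)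
    (hPb : ∀ᵐ z ∂P, z ⬝ᵥ pinv (secondMoment P) *ᵥ z ≤ 3 / 2 * b ^ 2) :
    μ {ω | ¬ NormBounded (fun i => Z i ω) (3 / √2 * b)} ≤ ENNReal.ofReal (2 * δ) := by
  rcases eq_or_ne n 0 with rfl | hn0
  · simp [NormBounded]
  set bad : Finset (Fin n) → Set Ω := fun H =>
    {ω | ∃ v, 3 * (v ⬝ᵥ scov (fun i => Z i ω) H *ᵥ v) < v ⬝ᵥ secondMoment P *ᵥ v}
  have hbad {H : Finset (Fin n)} (hH : 2 * H.card = n) : μ (bad H) ≤ ENNReal.ofReal δ :=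
    hZ.measure_exists_scov_half_lt_le hn0 hδ hnb hP hPb
      (by rw [eq_div_iff two_ne_zero, mul_comm]; exact_mod_cast hH)
  have hST := isWhitening_spectralRows (secondMoment_posSemidef hP)
  have hradius : 3 * (3 / 2 * b ^ 2) = (3 / √2 * b) ^ 2 := by
    rw [mul_pow, div_pow, Real.sq_sqrt zero_le_two]
    ring
  calc μ {ω | ¬ NormBounded (fun i => Z i ω) (3 / √2 * b)}
      ≤ μ (bad (firstHalf n) ∪ bad (secondHalf n)) := by
        refine measure_mono_ae ?_
        filter_upwards [hZ.ae (hST.ae_transpose_mulVec_mulVec_eq hP), hZ.ae hPb] with ω hrange hL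
        refine fun hω => by_contra fun hgood => hω ?_
        have hgood' : ω ∉ bad (firstHalf n) ∧ ω ∉ bad (secondHalf n) := not_or.1 hgood
        refine hST.normBounded zero_le_three hradius.le hrange hL fun H hH v => ?_
        rcases hH with rfl | rfl
        · exact not_lt.1 fun hv => hgood'.1 ⟨v, hv⟩
        · exact not_lt.1 fun hv => hgood'.2 ⟨v, hv⟩
    _ ≤ μ (bad (firstHalf n)) + μ (bad (secondHalf n)) := measure_union_le _ _
    _ ≤ ENNReal.ofReal δ + ENNReal.ofReal δ := by
        have heven := Nat.two_mul_div_two_of_even hn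
        exact add_le_add (hbad (by rwa [card_firstHalf])) (hbad (by rw [card_secondHalf]; omega))
    _ = ENNReal.ofReal (2 * δ) := by rw [← ENNReal.ofReal_add hδ.le hδ.le, two_mul]

end NormBounded

section Hoelder

variable {α : Type*} [MeasurableSpace α] {ν : Measure α} {f g : α → ℝ} {k : ℝ}

theorem holderConjugate_div_two_div_sub_two (hk : 2 < k) :
    (k / 2).HolderConjugate (k / (k - 2)) :=
  Real.holderConjugate_iff.2 ⟨by linarith, by field [sub_pos.2 hk]⟩

theorem memLp_sq_div_two (hf : MemLp f (ENNReal.ofReal k) ν) :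
    MemLp (fun x => f x ^ 2) (ENNReal.ofReal (k / 2)) ν := by
  simpa [ENNReal.ofReal_div_of_pos two_pos] using hf.norm_rpow_div (ENNReal.ofReal 2)

theorem memLp_rpow_sub_two (hk : 2 < k) (hg0 : ∀ x, 0 ≤ g x)
    (hg : MemLp g (ENNReal.ofReal k) ν) :
    MemLp (fun x => g x ^ (k - 2)) (ENNReal.ofReal (k / (k - 2))) ν := by
  have hk2 : 0 < k - 2 := sub_pos.2 hk
  simpa only [ENNReal.ofReal_div_of_pos hk2, ENNReal.toReal_ofReal hk2.le,
    Real.norm_of_nonneg (hg0 _)] using hg.norm_rpow_div (ENNReal.ofReal (k - 2))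

theorem integrable_sq_mul_rpow (hk : 2 < k) (hf : MemLp f (ENNReal.ofReal k) ν)
    (hg0 : ∀ x, 0 ≤ g x) (hg : MemLp g (ENNReal.ofReal k) ν) :
    Integrable (fun x => f x ^ 2 * g x ^ (k - 2)) ν :=
  have := (holderConjugate_div_two_div_sub_two hk).ennrealOfReal
  (memLp_sq_div_two hf).integrable_mul (memLp_rpow_sub_two hk hg0 hg)

theorem sq_rpow_div_two (k x : ℝ) : (x ^ 2) ^ (k / 2) = |x| ^ k := by
  rw [← sq_abs, ← Real.rpow_natCast_mul (abs_nonneg x), Nat.cast_two, mul_div_cancel₀ _ two_ne_zero]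

theorem integral_sq_mul_rpow_le (hk : 2 < k) (hf : MemLp f (ENNReal.ofReal k) ν)
    (hg0 : ∀ x, 0 ≤ g x) (hg : MemLp g (ENNReal.ofReal k) ν) :
    ∫ x, f x ^ 2 * g x ^ (k - 2) ∂ν ≤
      (∫ x, |f x| ^ k ∂ν) ^ (2 / k) * (∫ x, g x ^ k ∂ν) ^ ((k - 2) / k) := by
  have hgk (x : α) : (g x ^ (k - 2)) ^ (k / (k - 2)) = g x ^ k := by
    rw [← Real.rpow_mul (hg0 x), mul_div_cancel₀ _ (sub_pos.2 hk).ne']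
  simpa only [sq_rpow_div_two, hgk, one_div_div] using
    integral_mul_le_Lp_mul_Lq_of_nonneg (holderConjugate_div_two_div_sub_two hk)
      (ae_of_all ν fun x => sq_nonneg (f x))
      (ae_of_all ν fun x => Real.rpow_nonneg (hg0 x) (k - 2))
      (memLp_sq_div_two hf) (memLp_rpow_sub_two hk hg0 hg)

theorem sqrt_dotProduct_self_rpow_le {ι : Type*} [Fintype ι] (hk : 2 ≤ k) (x : ι → ℝ) :
    √(x ⬝ᵥ x) ^ k ≤ (Fintype.card ι : ℝ) ^ (k / 2 - 1) * ∑ a, |x a| ^ k :=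
  calc √(x ⬝ᵥ x) ^ k = (∑ a, |x a ^ 2|) ^ (k / 2) := by
        rw [← abs_of_nonneg (Real.sqrt_nonneg _), ← sq_rpow_div_two,
          Real.sq_sqrt (dotProduct_self_nonneg x)]
        simp only [dotProduct, abs_sq]
        simp only [sq]
    _ ≤ (Fintype.card ι : ℝ) ^ (k / 2 - 1) * ∑ a, |x a ^ 2| ^ (k / 2) :=
        Real.rpow_sum_le_const_mul_sum_rpow Finset.univ (f := fun a => x a ^ 2) (by linarith)
    _ = (Fintype.card ι : ℝ) ^ (k / 2 - 1) * ∑ a, |x a| ^ k := by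
        simp only [abs_sq, sq_rpow_div_two]

end Hoelder

section Clipping

variable {k m b : ℝ} {c : (Fin d → ℝ) → Fin d → ℝ}

theorem HasMomentBound.memLp_two [IsFiniteMeasure P] (hP : HasMomentBound P k m) (hk : 2 ≤ k) :
    MemLp (fun z : Fin d → ℝ => z) 2 P :=
  hP.1.mono_exponent (by simpa using ENNReal.ofReal_le_ofReal hk)

theorem HasMomentBound.integrable_rpow (hP : HasMomentBound P k m) (hk : 0 < k) (v : Fin d → ℝ) :
    Integrable (fun z => |v ⬝ᵥ z| ^ k) P := by
  simpa only [Real.norm_eq_abs, ENNReal.toReal_ofReal hk.le] using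
    (memLp_dotProduct hP.1 v).integrable_norm_rpow (by simpa using hk) ENNReal.ofReal_ne_top

theorem continuous_psdNorm (A : Matrix (Fin d) (Fin d) ℝ) : Continuous (psdNorm A) := by
  unfold psdNorm
  fun_prop

theorem psdNorm_nonneg (A : Matrix (Fin d) (Fin d) ℝ) (z : Fin d → ℝ) : 0 ≤ psdNorm A z :=
  Real.sqrt_nonneg _

theorem IsWhitening.psdNorm_rpow_le {ι : Type*} [Fintype ι] [DecidableEq ι]
    {S T : Matrix ι (Fin d) ℝ} {A : Matrix (Fin d) (Fin d) ℝ} (hST : IsWhitening A S T)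
    (hk : 2 ≤ k) (z : Fin d → ℝ) :
    psdNorm A z ^ k ≤ (A.rank : ℝ) ^ (k / 2 - 1) * ∑ a, |S.row a ⬝ᵥ z| ^ k := by
  rw [hST.psdNorm_eq, ← hST.card_eq_rank]
  exact sqrt_dotProduct_self_rpow_le hk (S *ᵥ z)

theorem HasMomentBound.memLp_psdNorm [IsFiniteMeasure P] (hP : HasMomentBound P k m)
    (hk : 2 ≤ k) : MemLp (psdNorm (secondMoment P)) (ENNReal.ofReal k) P := by
  have hk0 : 0 < k := by linarith
  have hST := isWhitening_spectralRows (secondMoment_posSemidef (hP.memLp_two hk))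
  set S := spectralRows (secondMoment_posSemidef (hP.memLp_two hk)).isHermitian fun x => (√x)⁻¹
  have hbound : Integrable (fun z => ((secondMoment P).rank : ℝ) ^ (k / 2 - 1) *
      ∑ a, |S.row a ⬝ᵥ z| ^ k) P :=
    (integrable_finsetSum _ fun a _ => hP.integrable_rpow hk0 (S.row a)).const_mul _
  have hmeas := (continuous_psdNorm (secondMoment P)).aestronglyMeasurable (μ := P)
  rw [← integrable_norm_rpow_iff hmeas (by simpa using hk0) ENNReal.ofReal_ne_top,
    ENNReal.toReal_ofReal hk0.le]
  refine hbound.mono' (hmeas.norm.aemeasurable.pow_const k).aestronglyMeasurable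
    (ae_of_all _ fun z => ?_)
  rw [Real.norm_of_nonneg (by positivity), Real.norm_of_nonneg (psdNorm_nonneg _ z)]
  exact hST.psdNorm_rpow_le hk z

theorem HasMomentBound.integral_psdNorm_rpow_le [IsFiniteMeasure P] (hP : HasMomentBound P k m)
    (hk : 2 ≤ k) (hm : 0 ≤ m) : ∫ z, psdNorm (secondMoment P) z ^ k ∂P ≤ (m * √d) ^ k := by
  have hk0 : 0 < k := by linarith
  have hST := isWhitening_spectralRows (secondMoment_posSemidef (hP.memLp_two hk))
  set S := spectralRows (secondMoment_posSemidef (hP.memLp_two hk)).isHermitian fun x => (√x)⁻¹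
  set r := (secondMoment P).rank
  have hrd : (r : ℝ) ≤ d := by
    exact_mod_cast (rank_le_card_height (secondMoment P)).trans_eq (Fintype.card_fin d)
  have hrow (a) : ∫ z, |S.row a ⬝ᵥ z| ^ k ∂P ≤ m ^ k := by
    simpa only [hST.row_dotProduct_mulVec_row, one_apply_eq, Real.one_rpow, mul_one] using
      hP.2 (S.row a)
  have hrow_int (a) := hP.integrable_rpow hk0 (S.row a)
  calc ∫ z, psdNorm (secondMoment P) z ^ k ∂P
      ≤ ∫ z, (r : ℝ) ^ (k / 2 - 1) * ∑ a, |S.row a ⬝ᵥ z| ^ k ∂P :=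
        integral_mono_of_nonneg (ae_of_all _ fun z => Real.rpow_nonneg (psdNorm_nonneg _ z) k)
          ((integrable_finsetSum _ fun a _ => hrow_int a).const_mul _)
          (ae_of_all _ (hST.psdNorm_rpow_le hk))
    _ = (r : ℝ) ^ (k / 2 - 1) * ∑ a, ∫ z, |S.row a ⬝ᵥ z| ^ k ∂P := by
        rw [integral_const_mul, integral_finsetSum _ fun a _ => hrow_int a]
    _ ≤ (r : ℝ) ^ (k / 2 - 1) * (r * m ^ k) := by
        gcongr
        refine (Finset.sum_le_card_nsmul _ _ _ fun a _ => hrow a).trans_eq ?_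
        rw [nsmul_eq_mul, Finset.card_univ, hST.card_eq_rank]
    _ = (r : ℝ) ^ (k / 2) * m ^ k := by
        rw [← mul_assoc, ← Real.rpow_add_one' (by positivity) (by linarith), sub_add_cancel]
    _ ≤ (d : ℝ) ^ (k / 2) * m ^ k := by gcongr
    _ = (m * √d) ^ k := by
        rw [Real.mul_rpow hm (Real.sqrt_nonneg _), Real.sqrt_eq_rpow, ← Real.rpow_mul d.cast_nonneg,
          one_div_mul_eq_div, mul_comm]

theorem HasMomentBound.integral_rpow_rpow_le (hP : HasMomentBound P k m) (hk : 0 < k) (hm : 0 ≤ m)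
    {v : Fin d → ℝ} (hv : 0 ≤ v ⬝ᵥ secondMoment P *ᵥ v) :
    (∫ z, |v ⬝ᵥ z| ^ k ∂P) ^ (2 / k) ≤ m ^ 2 * (v ⬝ᵥ secondMoment P *ᵥ v) :=
  calc (∫ z, |v ⬝ᵥ z| ^ k ∂P) ^ (2 / k)
      ≤ (m ^ k * (v ⬝ᵥ secondMoment P *ᵥ v) ^ (k / 2)) ^ (2 / k) :=
        Real.rpow_le_rpow (integral_nonneg fun z => by positivity) (hP.2 v) (by positivity)
    _ = m ^ 2 * (v ⬝ᵥ secondMoment P *ᵥ v) := by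
        rw [Real.mul_rpow (by positivity) (by positivity), ← Real.rpow_mul hm, ← Real.rpow_mul hv,
          mul_div_cancel₀ _ hk.ne', div_mul_div_cancel₀ two_ne_zero, div_self hk.ne', Real.rpow_one,
          Real.rpow_two]

theorem HasMomentBound.dotProduct_secondMoment_mulVec_le [IsProbabilityMeasure P]
    (hP : HasMomentBound P k m) (hk : 2 < k) (hm : 0 ≤ m) (v : Fin d → ℝ) :
    v ⬝ᵥ secondMoment P *ᵥ v ≤ m ^ 2 * (v ⬝ᵥ secondMoment P *ᵥ v) := by
  have hP2 := hP.memLp_two hk.le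
  calc v ⬝ᵥ secondMoment P *ᵥ v ≤ (∫ z, |v ⬝ᵥ z| ^ k ∂P) ^ (2 / k) := by
        simpa only [dotProduct_secondMoment_mulVec_self hP2, Real.one_rpow, mul_one, integral_const,
          probReal_univ, smul_eq_mul] using
          integral_sq_mul_rpow_le hk (memLp_dotProduct hP.1 v) (fun _ => zero_le_one)
            (memLp_const (1 : ℝ))
    _ ≤ m ^ 2 * (v ⬝ᵥ secondMoment P *ᵥ v) :=
        hP.integral_rpow_rpow_le (by linarith) hm
          (by simpa using (secondMoment_posSemidef hP2).dotProduct_mulVec_nonneg v)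

theorem HasMomentBound.integral_sq_mul_psdNorm_rpow_le [IsFiniteMeasure P]
    (hP : HasMomentBound P k m) (hk : 2 < k) (hm : 0 ≤ m) (v : Fin d → ℝ) :
    ∫ z, (v ⬝ᵥ z) ^ 2 * psdNorm (secondMoment P) z ^ (k - 2) ∂P ≤
      m ^ 2 * (m * √d) ^ (k - 2) * (v ⬝ᵥ secondMoment P *ᵥ v) := by
  have hk0 : 0 < k := by linarith
  have hk2 : 0 ≤ (k - 2) / k := div_nonneg (by linarith) hk0.le
  have hs : 0 ≤ v ⬝ᵥ secondMoment P *ᵥ v := by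
    simpa using (secondMoment_posSemidef (hP.memLp_two hk.le)).dotProduct_mulVec_nonneg v
  have hnorm : (∫ z, psdNorm (secondMoment P) z ^ k ∂P) ^ ((k - 2) / k) ≤ (m * √d) ^ (k - 2) :=
    calc (∫ z, psdNorm (secondMoment P) z ^ k ∂P) ^ ((k - 2) / k)
        ≤ ((m * √d) ^ k) ^ ((k - 2) / k) :=
          Real.rpow_le_rpow (integral_nonneg fun z => Real.rpow_nonneg (psdNorm_nonneg _ z) k)
            (hP.integral_psdNorm_rpow_le hk.le hm) hk2
      _ = (m * √d) ^ (k - 2) := by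
          rw [← Real.rpow_mul (by positivity), mul_div_cancel₀ _ hk0.ne']
  calc ∫ z, (v ⬝ᵥ z) ^ 2 * psdNorm (secondMoment P) z ^ (k - 2) ∂P
      ≤ (∫ z, |v ⬝ᵥ z| ^ k ∂P) ^ (2 / k) *
          (∫ z, psdNorm (secondMoment P) z ^ k ∂P) ^ ((k - 2) / k) :=
        integral_sq_mul_rpow_le hk (memLp_dotProduct hP.1 v) (psdNorm_nonneg _)
          (hP.memLp_psdNorm hk.le)
    _ ≤ (m ^ 2 * (v ⬝ᵥ secondMoment P *ᵥ v)) * (m * √d) ^ (k - 2) :=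
        mul_le_mul (hP.integral_rpow_rpow_le hk0 hm hs) hnorm
          (Real.rpow_nonneg (integral_nonneg fun z => Real.rpow_nonneg (psdNorm_nonneg _ z) k) _)
          (by positivity)
    _ = m ^ 2 * (m * √d) ^ (k - 2) * (v ⬝ᵥ secondMoment P *ᵥ v) := by ring

theorem IsClipping.mul_sq_sub_sq_le {A : Matrix (Fin d) (Fin d) ℝ} (hc : IsClipping A b c)
    (hb : 0 ≤ b) {p : ℝ} (hp : 0 ≤ p) (v z : Fin d → ℝ) :
    b ^ p * ((v ⬝ᵥ z) ^ 2 - (v ⬝ᵥ c z) ^ 2) ≤ (v ⬝ᵥ z) ^ 2 * psdNorm A z ^ p := by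
  have hnorm := psdNorm_nonneg A z
  rcases le_total (psdNorm A z) b with hzb | hbz
  · rw [hc.2.1 z hzb, sub_self, mul_zero]
    positivity
  · calc b ^ p * ((v ⬝ᵥ z) ^ 2 - (v ⬝ᵥ c z) ^ 2) ≤ b ^ p * (v ⬝ᵥ z) ^ 2 := by
          gcongr
          exact sub_le_self _ (sq_nonneg (v ⬝ᵥ c z))
      _ ≤ psdNorm A z ^ p * (v ⬝ᵥ z) ^ 2 := by gcongr
      _ = (v ⬝ᵥ z) ^ 2 * psdNorm A z ^ p := mul_comm _ _

theorem IsClipping.memLp {A : Matrix (Fin d) (Fin d) ℝ} (hc : IsClipping A b c) {p : ENNReal}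
    (hP : MemLp (fun z : Fin d → ℝ => z) p P) : MemLp c p P := by
  refine hP.mono hc.1.aestronglyMeasurable (ae_of_all _ fun z => ?_)
  obtain ⟨-, t, ht0, ht1, hcz⟩ := hc.2.2 z
  rw [hcz, norm_smul, Real.norm_of_nonneg ht0]
  exact mul_le_of_le_one_left (norm_nonneg z) ht1

theorem IsClipping.memLp_map {A : Matrix (Fin d) (Fin d) ℝ} (hc : IsClipping A b c) {p : ENNReal}
    (hP : MemLp (fun z : Fin d → ℝ => z) p P) : MemLp (fun z : Fin d → ℝ => z) p (P.map c) :=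
  (memLp_map_measure_iff aestronglyMeasurable_id hc.1.aemeasurable).2 (hc.memLp hP)

theorem IsClipping.dotProduct_secondMoment_map_mulVec {A : Matrix (Fin d) (Fin d) ℝ}
    (hc : IsClipping A b c) (hP : MemLp (fun z : Fin d → ℝ => z) 2 P) (v : Fin d → ℝ) :
    v ⬝ᵥ secondMoment (P.map c) *ᵥ v = ∫ z, (v ⬝ᵥ c z) ^ 2 ∂P := by
  rw [dotProduct_secondMoment_mulVec_self (hc.memLp_map hP), integral_map hc.1.aemeasurable]
  exact (by fun_prop : Continuous fun z : Fin d → ℝ => (v ⬝ᵥ z) ^ 2).aestronglyMeasurable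

theorem HasMomentBound.rpow_mul_sub_le [IsFiniteMeasure P] (hP : HasMomentBound P k m) (hk : 2 < k)
    (hm : 0 ≤ m) (hb : 0 ≤ b) (hc : IsClipping (secondMoment P) b c) (v : Fin d → ℝ) :
    b ^ (k - 2) * (v ⬝ᵥ secondMoment P *ᵥ v - v ⬝ᵥ secondMoment (P.map c) *ᵥ v) ≤
      m ^ 2 * (m * √d) ^ (k - 2) * (v ⬝ᵥ secondMoment P *ᵥ v) := by
  have hP2 := hP.memLp_two hk.le
  have hint : Integrable (fun z => (v ⬝ᵥ z) ^ 2) P := (memLp_dotProduct hP2 v).integrable_sq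
  have hint_clip : Integrable (fun z => (v ⬝ᵥ c z) ^ 2) P :=
    ((memLp_dotProduct (hc.memLp_map hP2) v).comp_of_map hc.1.aemeasurable).integrable_sq
  calc b ^ (k - 2) * (v ⬝ᵥ secondMoment P *ᵥ v - v ⬝ᵥ secondMoment (P.map c) *ᵥ v)
      = ∫ z, b ^ (k - 2) * ((v ⬝ᵥ z) ^ 2 - (v ⬝ᵥ c z) ^ 2) ∂P := by
        rw [dotProduct_secondMoment_mulVec_self hP2, hc.dotProduct_secondMoment_map_mulVec hP2,
          integral_const_mul, integral_sub hint hint_clip]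
    _ ≤ ∫ z, (v ⬝ᵥ z) ^ 2 * psdNorm (secondMoment P) z ^ (k - 2) ∂P :=
        integral_mono ((hint.sub hint_clip).const_mul _)
          (integrable_sq_mul_rpow hk (memLp_dotProduct hP.1 v) (psdNorm_nonneg _)
            (hP.memLp_psdNorm hk.le))
          fun z => hc.mul_sq_sub_sq_le hb (sub_nonneg.2 hk.le) v z
    _ ≤ m ^ 2 * (m * √d) ^ (k - 2) * (v ⬝ᵥ secondMoment P *ᵥ v) :=
        hP.integral_sq_mul_psdNorm_rpow_le hk hm v

variable [IsProbabilityMeasure P]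

theorem HasMomentBound.dotProduct_secondMoment_mulVec_eq_zero (hP : HasMomentBound P k m)
    (hk : 2 < k) (hm : 0 ≤ m) (hzero : m ^ 2 * (m * √d) ^ (k - 2) ≤ 0) (v : Fin d → ℝ) :
    v ⬝ᵥ secondMoment P *ᵥ v = 0 := by
  rcases hm.eq_or_lt with rfl | hm0
  · refine le_antisymm ?_ ?_
    · simpa using hP.dotProduct_secondMoment_mulVec_le hk le_rfl v
    · simpa using (secondMoment_posSemidef (hP.memLp_two hk.le)).dotProduct_mulVec_nonneg v
  · rcases d.eq_zero_or_pos with rfl | hd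
    · simp
    · exact absurd hzero (by push Not; positivity)

theorem HasMomentBound.dotProduct_secondMoment_mulVec_le_map (hP : HasMomentBound P k m)
    (hk : 2 < k) (hm : 0 ≤ m) (hb : 0 ≤ b) (hbm : 3 * m ^ 2 * (m * √d) ^ (k - 2) ≤ b ^ (k - 2))
    (hc : IsClipping (secondMoment P) b c) (v : Fin d → ℝ) :
    v ⬝ᵥ secondMoment P *ᵥ v ≤ 3 / 2 * (v ⬝ᵥ secondMoment (P.map c) *ᵥ v) := by
  have hP2 := hP.memLp_two hk.le
  have hs : 0 ≤ v ⬝ᵥ secondMoment P *ᵥ v := by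
    simpa using (secondMoment_posSemidef hP2).dotProduct_mulVec_nonneg v
  have hs_clip : 0 ≤ v ⬝ᵥ secondMoment (P.map c) *ᵥ v := by
    simpa using (secondMoment_posSemidef (hc.memLp_map hP2)).dotProduct_mulVec_nonneg v
  rcases hb.eq_or_lt with rfl | hb0
  · rw [Real.zero_rpow (by linarith)] at hbm
    rw [hP.dotProduct_secondMoment_mulVec_eq_zero hk hm (by linarith)]
    positivity
  have hbias : v ⬝ᵥ secondMoment P *ᵥ v - v ⬝ᵥ secondMoment (P.map c) *ᵥ v ≤
      1 / 3 * (v ⬝ᵥ secondMoment P *ᵥ v) := by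
    refine le_of_mul_le_mul_left ((hP.rpow_mul_sub_le hk hm hb hc v).trans ?_)
      (Real.rpow_pos_of_pos hb0 (k - 2))
    rw [← mul_assoc]
    exact mul_le_mul_of_nonneg_right (by linarith) hs
  linarith

theorem HasMomentBound.ae_map_dotProduct_pinv_mulVec_le (hP : HasMomentBound P k m)
    (hk : 2 < k) (hm : 0 ≤ m) (hb : 0 ≤ b) (hbm : 3 * m ^ 2 * (m * √d) ^ (k - 2) ≤ b ^ (k - 2))
    (hc : IsClipping (secondMoment P) b c) :
    ∀ᵐ z ∂P.map c, z ⬝ᵥ pinv (secondMoment (P.map c)) *ᵥ z ≤ 3 / 2 * b ^ 2 := by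
  have hA := secondMoment_posSemidef (hP.memLp_two hk.le)
  have hST := isWhitening_spectralRows hA
  rw [ae_map_iff hc.1.aemeasurable (measurableSet_le (by fun_prop) measurable_const)]
  filter_upwards [hST.ae_transpose_mulVec_mulVec_eq (hP.memLp_two hk.le)] with z hz
  obtain ⟨hcb, t, -, -, ht⟩ := hc.2.2 z
  calc c z ⬝ᵥ pinv (secondMoment (P.map c)) *ᵥ c z
      ≤ 3 / 2 * (c z ⬝ᵥ pinv (secondMoment P) *ᵥ c z) :=
        hST.dotProduct_pinv_mulVec_le (secondMoment_isHermitian _) (by norm_num)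
          (hP.dotProduct_secondMoment_mulVec_le_map hk hm hb hbm hc)
          (by rw [ht, mulVec_smul, mulVec_smul, hz])
    _ ≤ 3 / 2 * b ^ 2 := by
        rw [← psdNorm_sq hA]
        gcongr
        exact psdNorm_nonneg _ _

end Clipping

end HeavyTail

theorem mainTheorem3 :
    ∃ C : ℝ, 0 < C ∧
      ∀ (d n : ℕ) (δ b : ℝ), 0 < d → Even n → 0 < δ → δ < 1 →
        C * b ^ 2 * Real.log (2 * (d : ℝ) / δ) ≤ (n : ℝ) →
        ∀ {Ω : Type*} [MeasurableSpace Ω] (μ : Measure Ω) [IsProbabilityMeasure μ]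
          (P : Measure (Fin d → ℝ)) [IsProbabilityMeasure P],
          -- the clipped heavy-tailed sample
          (∀ (k m : ℝ) (c : (Fin d → ℝ) → Fin d → ℝ) (Z : Fin n → Ω → Fin d → ℝ),
            2 < k → 0 ≤ m → 0 ≤ b →
            HeavyTail.HasMomentBound P k m →
            3 * m ^ 2 * (m * √(d : ℝ)) ^ (k - 2) ≤ b ^ (k - 2) →
            HeavyTail.IsClipping (HeavyTail.secondMoment P) b c →
            HeavyTail.IsIIDSample Z P μ →
            μ {ω | ¬ HeavyTail.NormBounded (fun i => c (Z i ω)) (3 / √2 * b)}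
              ≤ ENNReal.ofReal (2 * δ)) ∧
          -- any sample whose law is bounded by `√(3/2) b` in the norm of its own second moment
          (∀ Zbar : Fin n → Ω → Fin d → ℝ,
            MemLp (fun z : Fin d → ℝ => z) 2 P →
            (∀ᵐ z ∂P, HeavyTail.psdNorm (HeavyTail.secondMoment P) z ≤ √(3 / 2) * b) →
            HeavyTail.IsIIDSample Zbar P μ →
            μ {ω | ¬ HeavyTail.NormBounded (fun i => Zbar i ω) (3 / √2 * b)}
              ≤ ENNReal.ofReal (2 * δ)) := by
  refine ⟨162, by norm_num, fun d n δ b _ hn hδ _ hnb {Ω} _ μ _ P _ => ⟨?_, ?_⟩⟩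
  · intro k m c Z hk hm hb hP hbm hc hZ
    have := Measure.isProbabilityMeasure_map (μ := P) hc.1.aemeasurable
    exact (hZ.comp hc.1).measure_not_normBounded_le hn hδ hnb (hc.memLp_map (hP.memLp_two hk.le))
      (hP.ae_map_dotProduct_pinv_mulVec_le hk hm hb hbm hc)
  · intro Zbar hP hPb hZbar
    refine hZbar.measure_not_normBounded_le hn hδ hnb hP ?_
    filter_upwards [hPb] with z hz
    calc z ⬝ᵥ HeavyTail.pinv (HeavyTail.secondMoment P) *ᵥ z
        = HeavyTail.psdNorm (HeavyTail.secondMoment P) z ^ 2 :=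
          (HeavyTail.psdNorm_sq (HeavyTail.secondMoment_posSemidef hP) z).symm
      _ ≤ (√(3 / 2) * b) ^ 2 := pow_le_pow_left₀ (HeavyTail.psdNorm_nonneg _ z) hz 2
      _ = 3 / 2 * b ^ 2 := by rw [mul_pow, Real.sq_sqrt (by norm_num)]
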